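/- For an integer $m\ge 2$ and a $T$-periodic sequence $s^\infty=(s_0,s_1,\dots)$ with terms in $\mathbb Z_m=\{0,\dots,m-1\}$, the $m$-adic complexity is $\Phi_m(s^\infty)=\lceil \log_m N\rceil$, where $N$ is the least value of $\max(|f|,c)$ over all integers $f$ and $c>0$ with $\gcd(c,m)=1$ such that $\sum_{i\ge 0}s_i m^i=f/c$ in the $m$-adic integers (equivalently, such that $s^\infty$ is generated by a feedback with carry shift register with connection integer $c$). It satisfies $\Phi_m(s^\infty)=\left\lceil \log_m\frac{m^T-1}{\gcd(S(m),\,m^T-1)}\right\rceil$ with $S(X)=\sum_{i=0}^{T-1}s_iX^i$. Let $p\ne q$ be odd primes with $\gcd(p-1,q-1)=4$. Let $g$ be any common primitive root modulo $p$ and modulo $q$, and let $h$ be any integer with $h\equiv g \pmod p$ and $h\equiv 1\pmod q$. Put $$D_i=\{g^sh^i \bmod pq : 0\le s<(p-1)(q-1)/4\}\quad (i=0,1,2,3),$$ $P=\{p,2p,\dots,(q-1)p\}$, $Q=\{q,2q,\dots,(p-1)q\}$, $R=\{0\}$, and let $e^\infty=(e_u)_{u\ge 0}$ be the quaternary sequence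 of period $pq$ with $e_u=2$ if $u \bmod pq\in Q\cup R$, $e_u=0$ if $u\bmod pq\in P$, and $e_u=i$ if $u\bmod pq\in D_i$, $i=0,1,2,3$. Let $r_1=\gcd(p+3,4^q-1)$, and let $r_2=\gcd(q-1,4^p-1)$ if $q\not\equiv 1\pmod 3$ and $r_2=\gcd(q-1,4^p-1)/3$ if $q\equiv 1\pmod 3$. Then: 1. if $p\equiv q+4\pmod 8$, then $$\Phi_4(e^\infty)\in\left\{\left\lceil\log_4\frac{4^{pq}-1}{\max(r_1,r_2)}\right\rceil,\ \left\lceil\log_4\frac{4^{pq}-1}{(2pq+1)\max(r_1,r_2)}\right\rceil\right\};$$ 2. if $p\equiv q\equiv 5\pmod 8$, then $$\Phi_4(e^\infty)\in\left\{\left\lceil\log_4\frac{4^{pq}-1}{\max(r_1,r_2)}\right\rceil,\ \left\lceil\log_4\frac{4^{pq}-1}{(6pq+1)\max(r_1,r_2)}\right\rceil\right\}.$$ -/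

import Mathlib

/-- `f / c` is the rational number whose `m`-adic expansion is the `m`-ary sequence `s`:
`c * (s 0 + s 1 * m + s 2 * m ^ 2 + ⋯) = f` in the `m`-adic integers, where the terms of `s` are
read as digits in `{0, …, m - 1}`.  Equivalently, `s` is the output of a feedback with carry shift
register over `ℤ / m` with connection integer `c`. -/
def IsFCSRFraction (m : ℕ) (s : ℕ → ZMod m) (f c : ℤ) : Prop :=
  0 < c ∧ IsCoprime c (m : ℤ) ∧
    ∀ n : ℕ, (m : ℤ) ^ n ∣ c * (∑ i ∈ Finset.range n, ((s i).val : ℤ) * (m : ℤ) ^ i) - f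

/-- The least size `max (|f|, c)` of a fraction `f / c` whose `m`-adic expansion is `s`. -/
noncomputable def fcsrSize (m : ℕ) (s : ℕ → ZMod m) : ℕ :=
  sInf {N : ℕ | ∃ f c : ℤ, IsFCSRFraction m s f c ∧ N = max f.natAbs c.natAbs}

/-- The `m`-adic complexity of an (eventually periodic) `m`-ary sequence `s`: the length, in base
`m` and rounded up, of a smallest feedback with carry shift register generating `s`. -/
noncomputable def mAdicComplexity (m : ℕ) (s : ℕ → ZMod m) : ℤ :=
  ⌈Real.logb (m : ℝ) (fcsrSize m s : ℝ)⌉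

/-- Consistency of the definition: the `m`-adic complexity of a `T`-periodic sequence with
generating polynomial `S(X) = ∑_{i < T} s_i X^i` is `⌈log_m ((m^T - 1) / gcd (S(m), m^T - 1))⌉`. -/
theorem mAdicComplexity_of_periodic (m : ℕ) (hm : 2 ≤ m) (s : ℕ → ZMod m) (T : ℕ) (hT : 0 < T)
    (hs : ∀ i, s (i + T) = s i) :
    mAdicComplexity m s =
      ⌈Real.logb (m : ℝ) (((m : ℝ) ^ T - 1) /
        (Nat.gcd (∑ i ∈ Finset.range T, (s i).val * m ^ i) (m ^ T - 1) : ℕ))⌉ := by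
  have : NeZero m := ⟨by omega⟩
  set S : ℕ := ∑ i ∈ Finset.range T, (s i).val * m ^ i with hS
  set M : ℕ := m ^ T - 1 with hM
  have hmT : m ^ T = M + 1 := by
    have : 0 < m ^ T := by positivity
    omega
  have hMpos : 0 < M := by
    have : m ^ 1 ≤ m ^ T := Nat.pow_le_pow_right (by omega) hT
    rw [pow_one] at this
    omega
  set A : ℕ → ℤ := fun n => ∑ i ∈ Finset.range n, ((s i).val : ℤ) * (m : ℤ) ^ i with hA
  have hmTz : (m : ℤ) ^ T = M + 1 := by exact_mod_cast hmT
  have hAT : A T = (S : ℤ) := by simp [hA, hS]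
  have hper : ∀ k i, s (i + k * T) = s i := by
    intro k
    induction k with
    | zero => intro i; simp
    | succ k ih => intro i; rw [Nat.succ_mul, ← add_assoc, hs, ih]
  -- the truncations after `k` periods
  have hAk : ∀ k : ℕ, A (k * T) * M = S * ((m : ℤ) ^ (k * T) - 1) := by
    intro k
    induction k with
    | zero => simp [hA]
    | succ k ih =>
      have h1 : A ((k + 1) * T) = A (k * T) + (m : ℤ) ^ (k * T) * S := by
        rw [← hAT]
        simp only [hA]
        rw [Nat.succ_mul, Finset.sum_range_add, Finset.mul_sum]
        congr 1
        refine Finset.sum_congr rfl fun i _ => ?_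
        rw [add_comm (k * T) i, hper, pow_add]
        ring
      rw [h1, add_mul, ih, Nat.succ_mul, pow_add, hmTz]
      ring
  have hSM : S ≤ M := by
    have h : ∀ n : ℕ, ∑ i ∈ Finset.range n, (s i).val * m ^ i + 1 ≤ m ^ n := by
      intro n
      induction n with
      | zero => simp
      | succ n ih =>
        rw [Finset.sum_range_succ, pow_succ]
        have h2 : (s n).val + 1 ≤ m := ZMod.val_lt (s n)
        have h3 : ((s n).val + 1) * m ^ n ≤ m * m ^ n := Nat.mul_le_mul_right _ h2
        nlinarith
    have := h T
    omega
  set g : ℕ := Nat.gcd S M with hg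
  have hgpos : 0 < g := Nat.gcd_pos_of_pos_right _ hMpos
  obtain ⟨S', hS'⟩ : g ∣ S := Nat.gcd_dvd_left _ _
  obtain ⟨M', hM'⟩ : g ∣ M := Nat.gcd_dvd_right _ _
  have hM'pos : 0 < M' := Nat.pos_of_ne_zero fun h => by simp [h] at hM'; omega
  have hcop : Nat.Coprime S' M' := by
    have h := Nat.gcd_mul_left g S' M'
    rw [← hS', ← hM', ← hg] at h
    exact Nat.eq_of_mul_eq_mul_left hgpos (by rw [← h, mul_one])
  have hMm : IsCoprime (M : ℤ) (m : ℤ) := by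
    refine ⟨-1, (m : ℤ) ^ (T - 1), ?_⟩
    have : (m : ℤ) ^ (T - 1) * m = M + 1 := by
      rw [← pow_succ, Nat.sub_add_cancel hT, hmTz]
    rw [this]; ring
  have hM'z : (M : ℤ) = g * M' := by exact_mod_cast hM'
  have hS'z : (S : ℤ) = g * S' := by exact_mod_cast hS'
  have hgm : IsCoprime (g : ℤ) (m : ℤ) := hMm.of_isCoprime_of_dvd_left ⟨M', hM'z⟩
  have hM'm : IsCoprime (M' : ℤ) (m : ℤ) :=
    hMm.of_isCoprime_of_dvd_left ⟨g, by rw [hM'z, mul_comm]⟩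
  have key : IsFCSRFraction m s (-(S' : ℤ)) (M' : ℤ) := by
    refine ⟨by exact_mod_cast hM'pos, hM'm, ?_⟩
    intro n
    have hdvd : (m : ℤ) ^ n ∣ A (n * T) - A n := by
      obtain ⟨t, ht⟩ : ∃ t, n * T = n + t := ⟨n * T - n, by
        have := Nat.le_mul_of_pos_right n hT
        omega⟩
      rw [ht]
      simp only [hA, Finset.sum_range_add, add_sub_cancel_left]
      refine Finset.dvd_sum fun i _ => ?_
      rw [pow_add]
      exact ⟨((s (n + i)).val : ℤ) * (m : ℤ) ^ i, by ring⟩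
    have h1 : (m : ℤ) ^ n ∣ (g : ℤ) * ((M' : ℤ) * A n - -(S' : ℤ)) := by
      have e : (g : ℤ) * ((M' : ℤ) * A n - -(S' : ℤ)) =
          S * (m : ℤ) ^ (n * T) - M * (A (n * T) - A n) := by
        have := hAk n
        have e2 : (g : ℤ) * ((M' : ℤ) * A n - -(S' : ℤ)) = M * A n + S := by
          rw [hM'z, hS'z]; ring
        rw [e2]
        linear_combination this
      rw [e]
      exact dvd_sub (Dvd.dvd.mul_left (pow_dvd_pow _ (Nat.le_mul_of_pos_right n hT)) _)
        (Dvd.dvd.mul_left hdvd _)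
    exact (hgm.symm.pow_left).dvd_of_dvd_mul_left h1
  have hsize : fcsrSize m s = M' := by
    unfold fcsrSize
    apply le_antisymm
    · apply Nat.sInf_le
      refine ⟨-(S' : ℤ), (M' : ℤ), key, ?_⟩
      have : S' ≤ M' := by
        rw [hS', hM'] at hSM
        exact Nat.le_of_mul_le_mul_left hSM hgpos
      simp [this]
    · refine le_csInf ⟨_, -(S' : ℤ), (M' : ℤ), key, rfl⟩ ?_
      rintro N ⟨f, c, ⟨hc, -, hd⟩, rfl⟩
      have hk : ∀ k : ℕ, (m : ℤ) ^ (k * T) ∣ c * S + f * M := by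
        intro k
        have h1 := (hd (k * T)).mul_right (M : ℤ)
        have e : c * S + f * M = c * S * (m : ℤ) ^ (k * T) - (c * A (k * T) - f) * M := by
          linear_combination c * hAk k
        rw [e]
        exact dvd_sub (Dvd.intro_left _ rfl) h1
      have hz : c * S + f * M = 0 := by
        by_contra hne
        have h1 := hk (c * S + f * M).natAbs
        have h2 := Int.natAbs_dvd_natAbs.mpr h1
        rw [Int.natAbs_pow, Int.natAbs_natCast] at h2
        have h3 := Nat.le_of_dvd (Int.natAbs_pos.mpr hne) h2
        have h4 := Nat.lt_pow_self (n := (c * S + f * M).natAbs * T) (show 1 < m by omega)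
        have h5 := Nat.le_mul_of_pos_right (c * S + f * M).natAbs hT
        omega
      have h6 : (g : ℤ) * (c * S' + f * M') = 0 := by
        rw [hM'z, hS'z] at hz
        linear_combination hz
      have h7 : c * S' + f * M' = 0 := by
        rcases mul_eq_zero.mp h6 with h | h
        · have : g = 0 := by exact_mod_cast h
          omega
        · exact h
      have h8 : (M' : ℤ) ∣ c := by
        have : (M' : ℤ) ∣ c * S' := ⟨-f, by linear_combination h7⟩
        exact (Nat.isCoprime_iff_coprime.mpr hcop).symm.dvd_of_dvd_mul_right this
      have h9 := Int.le_of_dvd hc h8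
      refine le_max_of_le_right ?_
      omega
  unfold mAdicComplexity
  rw [hsize]
  have hr : ((m : ℝ) ^ T - 1) / (g : ℝ) = M' := by
    have h1 : (m : ℝ) ^ T = M + 1 := by exact_mod_cast hmT
    have h2 : (M : ℝ) = g * M' := by exact_mod_cast hM'
    have h3 : (g : ℝ) ≠ 0 := by positivity
    rw [h1, add_sub_cancel_right, h2, mul_div_cancel_left₀ _ h3]
  rw [hr]

/-- Whiteman's generalized cyclotomic class `D_i` of order `4` modulo `p * q`:
`D_i = {g ^ s * h ^ i mod p q : 0 ≤ s < (p - 1) * (q - 1) / 4}`. -/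
def cyclotomicClass (p q : ℕ) (g h : ℤ) (i : ℕ) : Set (ZMod (p * q)) :=
  {x | ∃ s : ℕ, s < (p - 1) * (q - 1) / 4 ∧ x = ((g ^ s * h ^ i : ℤ) : ZMod (p * q))}

/-- `P = {p, 2 p, …, (q - 1) p}` in `ℤ / p q`. -/
def setP (p q : ℕ) : Set (ZMod (p * q)) :=
  {x | ∃ k : ℕ, 1 ≤ k ∧ k ≤ q - 1 ∧ x = ((k * p : ℕ) : ZMod (p * q))}

/-- `Q = {q, 2 q, …, (p - 1) q}` in `ℤ / p q`. -/
def setQ (p q : ℕ) : Set (ZMod (p * q)) :=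
  {x | ∃ k : ℕ, 1 ≤ k ∧ k ≤ p - 1 ∧ x = ((k * q : ℕ) : ZMod (p * q))}

open Classical in
/-- The two-prime quaternary sequence of period `p * q`: the `u`-th term is `2` on `Q ∪ {0}`,
`0` on `P`, and `i` on `D_i` for `i = 0, 1, 2, 3`.  (These sets partition `ℤ / p q`, so the last
branch is `D_0`.) -/
noncomputable def twoPrimeQuaternary (p q : ℕ) (g h : ℤ) (u : ℕ) : ZMod 4 :=
  if (u : ZMod (p * q)) ∈ setQ p q ∪ {0} then 2
  else if (u : ZMod (p * q)) ∈ setP p q then 0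
  else if (u : ZMod (p * q)) ∈ cyclotomicClass p q g h 1 then 1
  else if (u : ZMod (p * q)) ∈ cyclotomicClass p q g h 2 then 2
  else if (u : ZMod (p * q)) ∈ cyclotomicClass p q g h 3 then 3
  else 0

/-- `r₁ = gcd (p + 3, 4 ^ q - 1)`. -/
def rOne (p q : ℕ) : ℕ := Nat.gcd (p + 3) (4 ^ q - 1)

/-- `r₂ = gcd (q - 1, 4 ^ p - 1)`, divided by `3` when `q ≡ 1 (mod 3)`; the division is exact. -/
def rTwo (p q : ℕ) : ℕ :=
  if q ≡ 1 [MOD 3] then Nat.gcd (q - 1) (4 ^ p - 1) / 3 else Nat.gcd (q - 1) (4 ^ p - 1)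

/-! ### Divisors of the norms of the cyclotomic sums -/

/-! Let `n = p * q`, let `S` be the generating polynomial's value at 4, and factor `4^n - 1 = 3 * A
* B * K` with `A = (4^p - 1)/3`, `B = (4^q - 1)/3`, `K = Φ_n(4)`. On units the digit is a
combination of powers of one quartic character of `ℤ/pq`, so at roots of unity the polynomial is a
combination of products of Gauss sums. Cyclotomic minimal polynomials turn these values into
congruences for `S` modulo 3, `A`, `B`, `K` (`twoPrimePolynomial_congruences`). The first three give
gcds 1, `r₂`, `r₁`; size forces `r₁ = 1` or `r₂ = 1`, so their product is the maximum
(`gcd_four_pow_sub_one`).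

There remains `d = gcd(S, K)`. Modulo each of its primes 4 has order `n`, so `d = 1 + 2kn`. Modulo
`K` one has `2S = 3 - w + X` with `w² = n` and `X² = 4bw + 4εn`, where `ε = ±1` and `n = a² + b²`
comes from Jacobi sums. Putting `S = 0` and eliminating `w` shows that `d` divides `(9 + (1 - 4ε)n)²
- (6 + 4b)² n` (`exists_gcd_twoPrimeQuaternary`). This integer has size `O(n²)`, and studying its
cofactor leaves few values of `k`; congruences modulo 3, 7 and 8 remove all positive ones but `k =
1` (for `n ≡ 5 mod 8`) or `k = 3` (for `n ≡ 1 mod 8`). -/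

theorem eq_one_of_dvd_norm_of_mod_eight_eq_five {n a b d k : ℤ} (hn : n = a ^ 2 + b ^ 2)
    (hn8 : n % 8 = 5) (hb : Even b) (hn65 : 65 ≤ n) (hk : 1 ≤ k) (hd : d = 1 + 2 * k * n)
    (hdvd : d ∣ (5 * n + 9) ^ 2 - (6 + 4 * b) ^ 2 * n) (hd7 : ¬ (7 : ℤ) ∣ d)
    (hd8 : k ≤ 2 * n → d % 8 ≠ 5) : k = 1 := by
  obtain ⟨b', hb'⟩ := hb
  have hodd : a % 2 = 1 := by
    rcases Int.even_or_odd a with ⟨x, hx⟩ | ⟨x, hx⟩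
    · have : n = 4 * (x ^ 2 + b' ^ 2) := by rw [hn, hx, hb']; ring
      omega
    · omega
  obtain ⟨c, hc⟩ : ∃ c, b = 2 + 4 * c := by
    obtain ⟨x, hx⟩ : ∃ x, a = 2 * x + 1 := ⟨a / 2, by omega⟩
    obtain ⟨y, hy⟩ := Int.even_mul_succ_self x
    rcases Int.even_or_odd b' with ⟨z, hz⟩ | ⟨z, hz⟩
    · have : n = 8 * (y + 2 * z ^ 2) + 1 := by
        rw [hn, hx, hb', hz]; linear_combination 4 * hy
      omega
    · exact ⟨z, by omega⟩
  obtain ⟨m, hm⟩ : ∃ m, n = 8 * m + 5 := ⟨n / 8, by omega⟩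
  set M : ℤ := 100 * m ^ 2 + 72 * m + 11 - 4 * (7 * c + 4 * c ^ 2) * (8 * m + 5) with hM
  have hN : (5 * n + 9) ^ 2 - (6 + 4 * b) ^ 2 * n = 16 * M := by
    rw [hM, hc, hm]; ring
  have hd2 : IsCoprime d 16 := by
    have : IsCoprime d 2 := ⟨1, -(k * n), by rw [hd]; ring⟩
    simpa using this.pow_right (n := 4)
  obtain ⟨d', hd'⟩ : d ∣ M := hd2.dvd_of_dvd_mul_left (hN ▸ hdvd)
  -- Modulo `n` the multiple of `d` is 81 and `d` is 1, so `16 * d' ≡ 81`; `j` is the quotient. The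
  -- resulting formula `ht` for a square lying between 0 and `O(n)` bounds both `j` and `k`.
  obtain ⟨j, hj⟩ : ∃ j, j = 25 * n + 90 - (6 + 4 * b) ^ 2 - 32 * k * d' := ⟨_, rfl⟩
  have h16 : 16 * d' = 81 + j * n := by
    have : (5 * n + 9) ^ 2 - (6 + 4 * b) ^ 2 * n = 16 * (d * d') := by rw [hN, hd']
    rw [hj]; rw [hd] at this; linear_combination -this
  have ht : (6 + 4 * b) ^ 2 = 25 * n + 90 - j - 2 * k * (81 + j * n) := by
    rw [← h16, hj]; ring
  have hj8 : j % 8 = 3 := by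
    have : 16 * d' = 81 + 8 * (j * m) + 5 * j := by rw [h16, hm]; ring
    omega
  have htn : (6 + 4 * b) ^ 2 ≤ 75 + 31 * n := by nlinarith [sq_nonneg (5 * b - 8), sq_nonneg a]
  have hj0 : 3 ≤ j := by
    by_contra hlt
    have hj5 : j ≤ -5 := by omega
    have hkn : 0 ≤ k * n := by positivity
    nlinarith [mul_nonneg hkn (by linarith : (0 : ℤ) ≤ -5 - j),
      mul_nonneg (by linarith : 0 ≤ k - 1) (by linarith : 0 ≤ n - 65)]
  have hk4 : k ≤ 4 := by
    by_contra hlt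
    have : 15 ≤ k * j := by nlinarith
    nlinarith [sq_nonneg (6 + 4 * b), mul_nonneg (by linarith : 0 ≤ k * j - 15)
      (by linarith : 0 ≤ n)]
  have hj11 : j = 3 ∨ k = 1 := by
    by_contra! hne
    have h1 : 11 ≤ j := by omega
    have h2 : 2 ≤ k := by omega
    have : 22 ≤ k * j := by nlinarith
    have h3 : 26 ≤ k * j ∨ k * j < 26 := by omega
    nlinarith [sq_nonneg (6 + 4 * b), mul_nonneg (by linarith : 0 ≤ k * j - 22)
      (by linarith : 0 ≤ n)]
  rcases hj11 with rfl | h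
  swap
  · exact h
  interval_cases k
  · rfl
  -- Here `d = 1 + 4n ≡ 5` modulo 8.
  · have := hd8 (by omega)
    omega
  -- For `j = k = 3` the square equals `7(n - 57)`, which makes 7 divide `d = 1 + 6n`.
  · exfalso
    have h7 : (7 : ℤ) ∣ (6 + 4 * b) ^ 2 := ⟨n - 57, by linarith⟩
    obtain ⟨x, hx⟩ := Int.Prime.dvd_pow' (by norm_num : Nat.Prime 7) h7
    push_cast at hx
    apply hd7
    have : 7 * d = 7 * (7 * (6 * x ^ 2 + 49)) := by
      rw [hx] at ht; rw [hd]; linear_combination -6 * ht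
    exact ⟨_, mul_left_cancel₀ (by norm_num) this⟩
  -- For `j = 3`, `k = 4` the equation reads `a² = 3(5b² + 16b + 199)`. The bracket would then be
  -- divisible by 3, but it never is.
  · exfalso
    clear hN hd' h16 hj hdvd hM M
    have h3 : (3 : ℤ) ∣ a ^ 2 := ⟨5 * b ^ 2 + 16 * b + 199, by linarith⟩
    obtain ⟨x, hx⟩ := Int.Prime.dvd_pow' (by norm_num : Nat.Prime 3) h3
    push_cast at hx
    have h5 : 5 * b ^ 2 + 16 * b + 199 = 3 * x ^ 2 := by rw [hx] at hn; linarith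
    obtain ⟨y, hy | hy | hy⟩ : ∃ y, b = 3 * y ∨ b = 3 * y + 1 ∨ b = 3 * y + 2 :=
      ⟨b / 3, by omega⟩
    all_goals
      rw [hy] at h5
      ring_nf at h5
      omega

/-- The case `k ≥ 4` below confines `(a, b)` to the ellipse `17a² + (b - 24)² ≤ 1313`, whence this
box; the quotient is the value of `k` determined by `a` and `b`. -/
theorem finite_norm_exceptions : ∀ c ∈ Finset.Icc (-3 : ℤ) 15, ∀ x ∈ Finset.Icc (-4 : ℤ) 3,
    let a : ℤ := 2 * x + 1
    let b : ℤ := 4 * c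
    let n : ℤ := a ^ 2 + b ^ 2
    let k : ℤ := (89 + 48 * b + 7 * b ^ 2 - 9 * a ^ 2) / (2 * n - 162)
    n % 64 = 17 → 145 ≤ n → 2 * n - 162 ∣ 89 + 48 * b + 7 * b ^ 2 - 9 * a ^ 2 → 4 ≤ k →
      3 ∣ 1 + 2 * k * n ∨ (1 + 2 * k * n) % 8 = 5 := by
  decide +kernel

/-- The cofactor method again; now `4 ∣ b`, so 64 splits off instead of 16, and `j ≡ -1` modulo 8
within the bounds `-9 < j < 7` leaves a single `j`. -/
theorem eq_three_of_dvd_norm_of_mod_eight_eq_one {n a b d k : ℤ} (hn : n = a ^ 2 + b ^ 2)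
    (hn8 : n % 8 = 1) (hb : Even b) (hn65 : 65 ≤ n) (hk : 1 ≤ k) (hd : d = 1 + 2 * k * n)
    (hdvd : d ∣ (9 - 3 * n) ^ 2 - (6 + 4 * b) ^ 2 * n) (hn3 : ¬ (3 : ℤ) ∣ n)
    (hd3 : ¬ (3 : ℤ) ∣ d) (hd8 : k ≤ 2 * n → d % 8 ≠ 5) : k = 3 := by
  obtain ⟨b', hb'⟩ := hb
  have hodd : a % 2 = 1 := by
    rcases Int.even_or_odd a with ⟨x, hx⟩ | ⟨x, hx⟩
    · have : n = 4 * (x ^ 2 + b' ^ 2) := by rw [hn, hx, hb']; ring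
      omega
    · omega
  obtain ⟨c, hc⟩ : ∃ c, b = 4 * c := by
    obtain ⟨x, hx⟩ : ∃ x, a = 2 * x + 1 := ⟨a / 2, by omega⟩
    obtain ⟨y, hy⟩ := Int.even_mul_succ_self x
    rcases Int.even_or_odd b' with ⟨z, hz⟩ | ⟨z, hz⟩
    · exact ⟨z, by omega⟩
    · have : n = 8 * (y + 2 * (z ^ 2 + z)) + 5 := by
        rw [hn, hx, hb', hz]; linear_combination 4 * hy
      omega
  obtain ⟨m, hm⟩ : ∃ m, n = 8 * m + 1 := ⟨n / 8, by omega⟩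
  set M : ℤ := 9 * m ^ 2 - 9 * m - (3 * c + 4 * c ^ 2) * (8 * m + 1) with hM
  have hN : (9 - 3 * n) ^ 2 - (6 + 4 * b) ^ 2 * n = 64 * M := by
    rw [hM, hc, hm]; ring
  have hd2 : IsCoprime d 64 := by
    have : IsCoprime d 2 := ⟨1, -(k * n), by rw [hd]; ring⟩
    simpa using this.pow_right (n := 6)
  obtain ⟨d', hd'⟩ : d ∣ M := hd2.dvd_of_dvd_mul_left (hN ▸ hdvd)
  obtain ⟨j, hj⟩ : ∃ j, j = 9 * n - 54 - (6 + 4 * b) ^ 2 - 128 * k * d' := ⟨_, rfl⟩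
  have h64 : 64 * d' = 81 + j * n := by
    have : (9 - 3 * n) ^ 2 - (6 + 4 * b) ^ 2 * n = 64 * (d * d') := by rw [hN, hd']
    rw [hj]; rw [hd] at this; linear_combination -this
  have ht : (6 + 4 * b) ^ 2 = 9 * n - 54 - j - 2 * k * (81 + j * n) := by
    rw [← h64, hj]; ring
  have hj8 : j % 8 = 7 := by
    have : 64 * d' = 81 + 8 * (j * m) + j := by rw [h64, hm]; ring
    omega
  have htn : (6 + 4 * b) ^ 2 ≤ 228 + 19 * n := by nlinarith [sq_nonneg (b - 8), sq_nonneg a]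
  have hkn : 0 ≤ k * n := by positivity
  have hj1 : j = -1 := by
    have h1 : j < 7 := by
      by_contra! hlt
      nlinarith [sq_nonneg (6 + 4 * b), mul_nonneg hkn (by linarith : (0 : ℤ) ≤ j - 7),
        mul_nonneg (by linarith : 0 ≤ k - 1) (by linarith : 0 ≤ n - 65)]
    have h2 : -9 < j := by
      by_contra! hlt
      nlinarith [mul_nonneg hkn (by linarith : (0 : ℤ) ≤ -9 - j),
        mul_nonneg (by linarith : 0 ≤ k - 1) (by linarith : 0 ≤ n - 65)]
    omega
  subst hj1
  -- Now `n = 81 - 64 * d'`, so `n ≡ 17` modulo 64, and 81 is excluded by `3 ∤ n`.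
  have hn145 : 145 ≤ n := by omega
  have hk4 : k = 1 ∨ k = 2 ∨ k = 3 ∨ 4 ≤ k := by omega
  rcases hk4 with rfl | rfl | rfl | hk4
  -- Modulo 3 the equation reads `a² ≡ b² + 1`, forcing `3 ∣ b` and `3 ∤ a`; then 3 divides `1 + 2n
  -- = d`.
  · exfalso
    have h5 : 11 * a ^ 2 = 5 * b ^ 2 + 48 * b + 251 := by rw [hn] at ht; linarith
    obtain ⟨y, hy⟩ : ∃ y, b = 3 * y ∨ b = 3 * y + 1 ∨ b = 3 * y + 2 := ⟨b / 3, by omega⟩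
    obtain ⟨x, hx⟩ : ∃ x, a = 3 * x ∨ a = 3 * x + 1 ∨ a = 3 * x + 2 := ⟨a / 3, by omega⟩
    rcases hy with hy | hy | hy <;> rcases hx with hx | hx | hx <;> rw [hx, hy] at h5 hn <;>
      ring_nf at h5 hn <;> omega
  · have := hd8 (by omega)
    omega
  · rfl
  · exfalso
    have h1 : k * (2 * n - 162) = 89 + 48 * b + 7 * b ^ 2 - 9 * a ^ 2 := by
      linear_combination -ht - 9 * hn
    have h2 : 17 * a ^ 2 + (b - 24) ^ 2 ≤ 1313 := by
      nlinarith [mul_nonneg (by linarith : 0 ≤ k - 4) (by linarith : 0 ≤ 2 * n - 162)]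
    have hb2 : |b - 24| ≤ 37 := abs_le_of_sq_le_sq (by linarith [sq_nonneg a]) (by norm_num)
    have ha2 : |a| < 9 := abs_lt_of_sq_lt_sq (by linarith [sq_nonneg (b - 24)]) (by norm_num)
    rw [abs_le] at hb2
    rw [abs_lt] at ha2
    have hc1 : -3 ≤ c := by omega
    have hc2 : c ≤ 15 := by omega
    have hk2 : k ≤ 2 * n := by
      have h3 : k * 128 ≤ k * (2 * n - 162) := by gcongr; linarith
      linarith [sq_nonneg (b - 8), sq_nonneg a]
    obtain ⟨x, hx⟩ : ∃ x, a = 2 * x + 1 := ⟨a / 2, by omega⟩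
    have hfin := finite_norm_exceptions c (Finset.mem_Icc.mpr ⟨hc1, hc2⟩) x
      (Finset.mem_Icc.mpr ⟨by omega, by omega⟩)
    simp only at hfin
    rw [← hx, ← hc, ← hn, ← h1, Int.mul_ediv_cancel _ (by omega), ← hd] at hfin
    rcases hfin (by omega) hn145 (Dvd.intro_left _ rfl) hk4 with h | h
    · exact hd3 h
    · exact hd8 hk2 h

/-! ### Reduction of identities between algebraic integers -/

/-- Transfers identities between Gauss sums at `ζ` to integer congruences: `Φ_N` is the minimal
polynomial of `ζ` over `ℤ`, hence divides `F`. -/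
theorem cyclotomic_eval_dvd_of_aeval_eq_zero {N : ℕ} (hN : 0 < N) {ζ : ℂ}
    (hζ : IsPrimitiveRoot ζ N) {F : Polynomial ℤ} (hF : Polynomial.aeval ζ F = 0) (x : ℤ) :
    (Polynomial.cyclotomic N ℤ).eval x ∣ F.eval x := by
  rw [Polynomial.cyclotomic_eq_minpoly hζ hN]
  exact Polynomial.eval_dvd (minpoly.isIntegrallyClosed_dvd (hζ.isIntegral hN) hF)

theorem exists_eq_add_mul_I_of_mem_adjoin {z : ℂ} (h : z ∈ Algebra.adjoin ℤ {Complex.I}) :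
    ∃ x y : ℤ, z = x + y * Complex.I := by
  induction h using Algebra.adjoin_induction with
  | mem x hx => exact ⟨0, 1, by simpa using hx⟩
  | algebraMap r => exact ⟨r, 0, by simp⟩
  | add a b _ _ ha hb =>
    obtain ⟨x, y, rfl⟩ := ha
    obtain ⟨x', y', rfl⟩ := hb
    exact ⟨x + x', y + y', by push_cast; ring⟩
  | mul a b _ _ ha hb =>
    obtain ⟨x, y, rfl⟩ := ha
    obtain ⟨x', y', rfl⟩ := hb
    exact ⟨x * x' - y * y', x * y' + y * x',
      by push_cast; linear_combination (y * y' : ℂ) * Complex.I_mul_I⟩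

/-! ### Quartic characters and their Gauss sums -/

section PrimitiveRoot

variable {p : ℕ} [Fact p.Prime] {g : ZMod p}

theorem ne_zero_of_orderOf_eq (hg : orderOf g = p - 1) : g ≠ 0 := by
  rintro rfl
  have := (Fact.out : p.Prime).two_le
  have h := pow_orderOf_eq_one (0 : ZMod p)
  rw [hg, zero_pow (by omega)] at h
  exact zero_ne_one h

theorem mem_zpowers_of_orderOf_eq (hg : orderOf g = p - 1) (x : (ZMod p)ˣ) :
    x ∈ Subgroup.zpowers (Units.mk0 g (ne_zero_of_orderOf_eq hg)) := by
  have : Subgroup.zpowers (Units.mk0 g (ne_zero_of_orderOf_eq hg)) = ⊤ := by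
    apply Subgroup.eq_top_of_card_eq
    rw [Nat.card_zpowers, ← orderOf_units, Units.val_mk0, hg, Nat.card_eq_fintype_card,
      ZMod.card_units]
  rw [this]
  exact Subgroup.mem_top x

theorem exists_pow_eq_of_orderOf_eq (hg : orderOf g = p - 1) {x : ZMod p} (hx : x ≠ 0) :
    ∃ n : ℕ, g ^ n = x := by
  obtain ⟨n, hn⟩ := mem_powers_iff_mem_zpowers.mpr (mem_zpowers_of_orderOf_eq hg (Units.mk0 x hx))
  exact ⟨n, by simpa using congrArg Units.val hn⟩

theorem exists_mulChar_apply_eq (hg : orderOf g = p - 1) {μ : ℂ} (hμ : μ ^ (p - 1) = 1) :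
    ∃ χ : MulChar (ZMod p) ℂ, χ g = μ := by
  have hp := (Fact.out : p.Prime).two_le
  have hμ0 : μ ≠ 0 := by
    rintro rfl
    rw [zero_pow (by omega)] at hμ
    exact zero_ne_one hμ
  have h : Units.mk0 μ hμ0 ∈ rootsOfUnity (Fintype.card (ZMod p)ˣ) ℂ := by
    rw [mem_rootsOfUnity, ZMod.card_units]
    ext
    simpa using hμ
  refine ⟨MulChar.ofRootOfUnity h (mem_zpowers_of_orderOf_eq hg), ?_⟩
  simpa using MulChar.ofRootOfUnity_spec h (mem_zpowers_of_orderOf_eq hg)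

theorem mulChar_eq_one_of_apply_eq_one (hg : orderOf g = p - 1) {χ : MulChar (ZMod p) ℂ}
    (h : χ g = 1) : χ = 1 := by
  have := MulChar.eq_iff (mem_zpowers_of_orderOf_eq hg) χ 1
  rw [this, MulChar.one_apply_coe]
  simpa using h

theorem pow_half_eq_neg_one (hg : orderOf g = p - 1) (hp : 4 ∣ p - 1) :
    g ^ ((p - 1) / 2) = -1 := by
  have hp1 := (Fact.out : p.Prime).one_lt
  have h2 : (g ^ ((p - 1) / 2)) ^ 2 = 1 := by
    rw [← pow_mul, Nat.div_mul_cancel (by omega), ← hg, pow_orderOf_eq_one]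
  rcases mul_self_eq_one_iff.mp ((sq _).symm.trans h2) with h | h
  · have := orderOf_dvd_of_pow_eq_one h
    have := Nat.le_of_dvd (by omega) this
    omega
  · exact h

variable {χ : MulChar (ZMod p) ℂ}

theorem quartic_pow_four (hg : orderOf g = p - 1) (h : χ g ^ 2 = -1) : χ ^ 4 = 1 :=
  mulChar_eq_one_of_apply_eq_one hg (by
    rw [MulChar.pow_apply' _ (by norm_num), show χ g ^ 4 = (χ g ^ 2) ^ 2 by ring, h]; norm_num)

theorem quartic_sq_ne_one (h : χ g ^ 2 = -1) (hg : orderOf g = p - 1) : χ ^ 2 ≠ 1 := by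
  intro h1
  have h2 : (χ ^ 2) g = 1 := by
    rw [h1, MulChar.one_apply (IsUnit.mk0 _ (ne_zero_of_orderOf_eq hg))]
  rw [MulChar.pow_apply' _ (by norm_num), h] at h2
  norm_num at h2

theorem quartic_cube_eq_inv (hg : orderOf g = p - 1) (h : χ g ^ 2 = -1) : χ ^ 3 = χ⁻¹ :=
  eq_inv_of_mul_eq_one_left (by rw [← pow_succ, quartic_pow_four hg h])

theorem quartic_sq_isQuadratic (hg : orderOf g = p - 1) (h : χ g ^ 2 = -1) :
    (χ ^ 2).IsQuadratic := by
  rw [MulChar.isQuadratic_iff_sq_eq_one, ← pow_mul, quartic_pow_four hg h]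

theorem quartic_apply_neg_one (hg : orderOf g = p - 1) (h : χ g ^ 2 = -1) (hp : 4 ∣ p - 1) :
    χ (-1) = (-1) ^ ((p - 1) / 4) := by
  rw [← pow_half_eq_neg_one hg hp, map_pow, ← h, ← pow_mul]
  congr 1
  omega

/-- Here `a + bi` is the Jacobi sum `J(χ, χ)`, with `G(χ)² = J(χ, χ) G(χ²)`. Evenness of `b` comes
from `J(χ, χ) ≡ -1` modulo `(i - 1)² = -2i`; since `χ³ = χ⁻¹`, the other square involves the
conjugate. -/
theorem gaussSum_quartic_relations (hg : orderOf g = p - 1) (h : χ g ^ 2 = -1) (hp : 4 ∣ p - 1)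
    {ψ : AddChar (ZMod p) ℂ} (hψ : ψ.IsPrimitive) :
    gaussSum χ ψ * gaussSum (χ ^ 3) ψ = (-1) ^ ((p - 1) / 4) * p ∧
    gaussSum (χ ^ 2) ψ ^ 2 = p ∧
    ∃ a b : ℤ, Even b ∧ a ^ 2 + b ^ 2 = p ∧
      gaussSum χ ψ ^ 2 = (a + b * Complex.I) * gaussSum (χ ^ 2) ψ ∧
      gaussSum (χ ^ 3) ψ ^ 2 = (a - b * Complex.I) * gaussSum (χ ^ 2) ψ := by
  have hsq := quartic_sq_ne_one h hg
  have hχ1 : χ ≠ 1 := by rintro rfl; exact hsq (one_pow 2)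
  have h4 := quartic_pow_four hg h
  have h3 := quartic_cube_eq_inv hg h
  have hm1 := quartic_apply_neg_one hg h hp
  have hinv2 : χ⁻¹ * χ⁻¹ = χ ^ 2 := by
    rw [← h3, ← pow_add, show 3 + 3 = 4 + 2 by rfl, pow_add, h4, one_mul]
  refine ⟨?_, ?_, ?_⟩
  · have h1 := gaussSum_mul_gaussSum_eq_card hχ1 hψ
    have h2 := mul_gaussSum_inv_eq_gaussSum χ⁻¹ ψ
    rw [MulChar.inv_apply', inv_neg_one, hm1] at h2
    rw [h3, ← h2, mul_left_comm, h1, ZMod.card]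
  · rw [gaussSum_sq hsq (quartic_sq_isQuadratic hg h) hψ, MulChar.pow_apply' _ (by norm_num), hm1,
      ZMod.card, ← pow_mul, mul_comm _ 2, pow_mul]
    norm_num
  · obtain ⟨z, hz, hJ⟩ := exists_jacobiSum_eq_neg_one_add (n := 4) (by norm_num) h4 h4
      (by rwa [ZMod.card]) Complex.isPrimitiveRoot_I
    obtain ⟨x, y, rfl⟩ := exists_eq_add_mul_I_of_mem_adjoin hz
    have hJ1 : jacobiSum χ χ = ((2 * y - 1 : ℤ) : ℂ) + (-2 * x : ℤ) * Complex.I := by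
      rw [hJ]
      push_cast
      linear_combination (x + y * (Complex.I - 2)) * Complex.I_sq
    have hJ2 : jacobiSum χ⁻¹ χ⁻¹ = ((2 * y - 1 : ℤ) : ℂ) - (-2 * x : ℤ) * Complex.I := by
      have : jacobiSum χ⁻¹ χ⁻¹ = starRingEnd ℂ (jacobiSum χ χ) := by
        rw [jacobiSum, jacobiSum, map_sum]
        refine Finset.sum_congr rfl fun t _ => ?_
        rw [map_mul, ← MulChar.star_apply', ← MulChar.star_apply']
        rfl
      rw [this, hJ1, map_add, map_mul, Complex.conj_I, map_intCast, map_intCast]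
      ring
    refine ⟨2 * y - 1, -2 * x, ⟨-x, by ring⟩, ?_, ?_, ?_⟩
    · have := jacobiSum_mul_jacobiSum_inv (F := ZMod p) (F' := ℂ) (by
        rw [ringChar.eq_zero, ZMod.ringChar_zmod_n]
        exact (Fact.out : p.Prime).ne_zero.symm) hχ1 hχ1 (by rwa [← sq])
      rw [hJ1, hJ2, ZMod.card] at this
      have h' : (((2 * y - 1) ^ 2 + (-2 * x) ^ 2 : ℤ) : ℂ) = (p : ℤ) := by
        push_cast at this ⊢
        linear_combination this + 4 * (x : ℂ) ^ 2 * Complex.I_sq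
      exact_mod_cast h'
    · have := jacobiSum_mul_nontrivial (χ := χ) (φ := χ) (by rwa [← sq]) ψ
      rw [← sq, ← sq, hJ1] at this
      rw [← this, mul_comm]
    · have := jacobiSum_mul_nontrivial (χ := χ⁻¹) (φ := χ⁻¹) (by rwa [hinv2]) ψ
      rw [hinv2, ← sq, hJ2] at this
      rw [h3, ← this, mul_comm]

end PrimitiveRoot

/-- Now `a + bi` is the product of the two Jacobi sums. As `(-1 ± i)² = ∓2i`, the two squares
contribute only its imaginary part, and the cross term is `4εpq`. -/
theorem two_prime_gaussSum_relations {p q : ℕ} [Fact p.Prime] [Fact q.Prime] {g : ZMod p}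
    {g' : ZMod q} (hg : orderOf g = p - 1) (hg' : orderOf g' = q - 1) {χ : MulChar (ZMod p) ℂ}
    {χ' : MulChar (ZMod q) ℂ} (h : χ g ^ 2 = -1) (h' : χ' g' ^ 2 = -1) (hp : 4 ∣ p - 1)
    (hq : 4 ∣ q - 1) {ψ : AddChar (ZMod p) ℂ} {ψ' : AddChar (ZMod q) ℂ} (hψ : ψ.IsPrimitive)
    (hψ' : ψ'.IsPrimitive) :
    (gaussSum (χ ^ 2) ψ * gaussSum (χ' ^ 2) ψ') ^ 2 = p * q ∧
    ∃ a b : ℤ, Even b ∧ a ^ 2 + b ^ 2 = p * q ∧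
      ((-1 + Complex.I) * (gaussSum χ ψ * gaussSum χ' ψ') +
        (-1 - Complex.I) * (gaussSum (χ ^ 3) ψ * gaussSum (χ' ^ 3) ψ')) ^ 2 =
      4 * b * (gaussSum (χ ^ 2) ψ * gaussSum (χ' ^ 2) ψ') +
        4 * (-1) ^ ((p - 1) / 4 + (q - 1) / 4) * (p * q) := by
  obtain ⟨h13, h2, a, b, hb, hab, h1, h3⟩ := gaussSum_quartic_relations hg h hp hψ
  obtain ⟨h13', h2', a', b', hb', hab', h1', h3'⟩ := gaussSum_quartic_relations hg' h' hq hψ'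
  refine ⟨by rw [mul_pow, h2, h2'], a * a' - b * b', a * b' + b * a',
    (hb'.mul_left a).add (hb.mul_right a'), by rw [← hab, ← hab']; ring, ?_⟩
  rw [pow_add]
  set u := gaussSum χ ψ
  set u' := gaussSum χ' ψ'
  set v := gaussSum (χ ^ 3) ψ
  set v' := gaussSum (χ' ^ 3) ψ'
  set w := gaussSum (χ ^ 2) ψ * gaussSum (χ' ^ 2) ψ' with hw
  have e1 : (u * u') ^ 2 = (a + b * Complex.I) * (a' + b' * Complex.I) * w := by
    rw [mul_pow, h1, h1', hw]; ring
  have e3 : (v * v') ^ 2 = (a - b * Complex.I) * (a' - b' * Complex.I) * w := by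
    rw [mul_pow, h3, h3', hw]; ring
  have e13 : (u * u') * (v * v') =
      ((-1) ^ ((p - 1) / 4) * (-1) ^ ((q - 1) / 4)) * (p * q) := by
    rw [mul_mul_mul_comm, h13, h13']; ring
  push_cast
  linear_combination (-1 + Complex.I) ^ 2 * e1 + (-1 - Complex.I) ^ 2 * e3 + 4 * e13 +
    (2 * (a * a' + b * b' * Complex.I ^ 2) * w - 4 * (a * b' + b * a') * w
      - 2 * (u * u') * (v * v')) * Complex.I_sq

/-! ### The sequence in terms of characters -/

section Sequence

variable {p q : ℕ}

theorem natCast_mem_setQ_union_zero_iff (hp : 0 < p) (u : ℕ) :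
    (u : ZMod (p * q)) ∈ setQ p q ∪ {0} ↔ q ∣ u := by
  constructor
  · rintro (⟨k, -, -, hk⟩ | h)
    · rw [ZMod.natCast_eq_natCast_iff] at hk
      exact ((hk.of_mul_left p).dvd_iff dvd_rfl).mpr (dvd_mul_left q k)
    · rw [Set.mem_singleton_iff, ZMod.natCast_eq_zero_iff] at h
      exact (dvd_mul_left q p).trans h
  · rintro ⟨k, rfl⟩
    rcases Nat.eq_zero_or_pos (k % p) with h | h
    · right
      rw [Set.mem_singleton_iff, ZMod.natCast_eq_zero_iff, mul_comm p q]
      exact mul_dvd_mul_left q (Nat.dvd_of_mod_eq_zero h)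
    · left
      refine ⟨k % p, h, Nat.le_sub_one_of_lt (Nat.mod_lt k hp), ?_⟩
      rw [ZMod.natCast_eq_natCast_iff, mul_comm q k]
      exact (Nat.mod_modEq k p).symm.mul_right' q

theorem natCast_mem_setP_iff (hq : 0 < q) {u : ℕ} (hqu : ¬ q ∣ u) :
    (u : ZMod (p * q)) ∈ setP p q ↔ p ∣ u := by
  constructor
  · rintro ⟨k, -, -, hk⟩
    rw [ZMod.natCast_eq_natCast_iff] at hk
    exact ((hk.of_mul_right q).dvd_iff dvd_rfl).mpr (dvd_mul_left p k)
  · rintro ⟨k, rfl⟩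
    have h : 0 < k % q := Nat.pos_of_ne_zero fun h =>
      hqu ((Nat.dvd_of_mod_eq_zero h).mul_left p)
    refine ⟨k % q, h, Nat.le_sub_one_of_lt (Nat.mod_lt k hq), ?_⟩
    rw [ZMod.natCast_eq_natCast_iff, mul_comm _ p]
    exact (Nat.mod_modEq k q).symm.mul_left' p

theorem natCast_eq_of_mem_cyclotomicClass {g h : ℤ} (hhp : h ≡ g [ZMOD (p : ℤ)])
    (hhq : h ≡ 1 [ZMOD (q : ℤ)]) {u i : ℕ} (hu : (u : ZMod (p * q)) ∈ cyclotomicClass p q g h i) :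
    ∃ s : ℕ, (u : ZMod p) = (g : ZMod p) ^ (s + i) ∧ (u : ZMod q) = (g : ZMod q) ^ s := by
  obtain ⟨s, -, hs⟩ := hu
  refine ⟨s, ?_, ?_⟩
  · have h1 := congrArg (ZMod.castHom (dvd_mul_right p q) (ZMod p)) hs
    rw [map_natCast, map_intCast] at h1
    rw [h1, Int.cast_mul, Int.cast_pow, Int.cast_pow, (ZMod.intCast_eq_intCast_iff _ _ _).mpr hhp,
      pow_add]
  · have h1 := congrArg (ZMod.castHom (dvd_mul_left q p) (ZMod q)) hs
    rw [map_natCast, map_intCast] at h1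
    rw [h1, Int.cast_mul, Int.cast_pow, Int.cast_pow, (ZMod.intCast_eq_intCast_iff _ _ _).mpr hhq,
      Int.cast_one, one_pow, mul_one]

/-- If `u` is `g^x` modulo `p` and `g^y` modulo `q`, one needs `s + i ≡ x` modulo `p - 1` and `s ≡
y` modulo `q - 1`. This is solvable when `i ≡ x - y` modulo 4, with `s` below the lcm `(p - 1)(q -
1)/4`. -/
theorem exists_mem_cyclotomicClass [Fact p.Prime] [Fact q.Prime] (hpq : p ≠ q)
    (hgcd : Nat.gcd (p - 1) (q - 1) = 4) {g h : ℤ} (hgp : orderOf (g : ZMod p) = p - 1)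
    (hgq : orderOf (g : ZMod q) = q - 1) (hhp : h ≡ g [ZMOD (p : ℤ)])
    (hhq : h ≡ 1 [ZMOD (q : ℤ)]) {u : ℕ} (hpu : (u : ZMod p) ≠ 0) (hqu : (u : ZMod q) ≠ 0) :
    ∃ i < 4, (u : ZMod (p * q)) ∈ cyclotomicClass p q g h i := by
  have hp2 := (Fact.out : p.Prime).two_le
  have hq2 := (Fact.out : q.Prime).two_le
  obtain ⟨x, hx⟩ := exists_pow_eq_of_orderOf_eq hgp hpu
  obtain ⟨y, hy⟩ := exists_pow_eq_of_orderOf_eq hgq hqu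
  have h4p : 4 ∣ p - 1 := hgcd ▸ Nat.gcd_dvd_left _ _
  -- `3 * y` plays the role of `-y` modulo 4, and the added `p - 1 ≥ 4` keeps the subtraction from
  -- truncating.
  have hcong : x + (p - 1) - (x + 3 * y) % 4 ≡ y [MOD Nat.gcd (p - 1) (q - 1)] := by
    rw [hgcd, Nat.ModEq]
    omega
  obtain ⟨s, hs⟩ : ∃ s, s = (Nat.chineseRemainder' hcong : ℕ) := ⟨_, rfl⟩
  have hs1 := (Nat.chineseRemainder' hcong).2.1
  have hs2 := (Nat.chineseRemainder' hcong).2.2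
  have hs3 := Nat.chineseRemainder'_lt_lcm hcong (by omega) (by omega)
  rw [← hs] at hs1 hs2 hs3
  rw [Nat.lcm, hgcd] at hs3
  refine ⟨(x + 3 * y) % 4, Nat.mod_lt _ (by norm_num), s, hs3, ?_⟩
  have hcop : p.Coprime q := (Nat.coprime_primes Fact.out Fact.out).mpr hpq
  have hp' : (u : ZMod p) = ((g ^ s * h ^ ((x + 3 * y) % 4) : ℤ) : ZMod p) := by
    rw [Int.cast_mul, Int.cast_pow, Int.cast_pow, (ZMod.intCast_eq_intCast_iff _ _ _).mpr hhp,
      ← pow_add, ← hx]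
    have e : s + (x + 3 * y) % 4 ≡ x [MOD p - 1] := by
      have := hs1.add_right ((x + 3 * y) % 4)
      rw [Nat.sub_add_cancel (by omega)] at this
      exact this.trans (by simp [Nat.ModEq])
    rw [← hgp] at e
    exact pow_eq_pow_of_modEq e.symm (pow_orderOf_eq_one _)
  have hq' : (u : ZMod q) = ((g ^ s * h ^ ((x + 3 * y) % 4) : ℤ) : ZMod q) := by
    rw [Int.cast_mul, Int.cast_pow, Int.cast_pow, (ZMod.intCast_eq_intCast_iff _ _ _).mpr hhq,
      Int.cast_one, one_pow, mul_one, ← hy]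
    rw [← hgq] at hs2
    exact pow_eq_pow_of_modEq hs2.symm (pow_orderOf_eq_one _)
  apply (ZMod.chineseRemainder hcop).injective
  rw [map_natCast, map_intCast]
  exact Prod.ext (by simpa using hp') (by simpa using hq')

theorem twoPrimeQuaternary_periodic (g h : ℤ) (u : ℕ) :
    twoPrimeQuaternary p q g h (u + p * q) = twoPrimeQuaternary p q g h u := by
  have : ((u + p * q : ℕ) : ZMod (p * q)) = u := by
    rw [Nat.cast_add, ZMod.natCast_self, add_zero]
  rw [twoPrimeQuaternary, twoPrimeQuaternary, this]

/-- Discrete Fourier expansion of the digit. The opposite choices `i` and `-i` cancel the power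
`g^s`, so `χχ'` equals `i^j` on `D_j`; the last term gives the digit 2 on multiples of `q`. -/
theorem two_mul_twoPrimeQuaternary_val [Fact p.Prime] [Fact q.Prime] (hpq : p ≠ q)
    (hgcd : Nat.gcd (p - 1) (q - 1) = 4) {g h : ℤ} (hgp : orderOf (g : ZMod p) = p - 1)
    (hgq : orderOf (g : ZMod q) = q - 1) (hhp : h ≡ g [ZMOD (p : ℤ)])
    (hhq : h ≡ 1 [ZMOD (q : ℤ)]) {χ : MulChar (ZMod p) ℂ} {χ' : MulChar (ZMod q) ℂ}
    (hχ : χ (g : ZMod p) = Complex.I) (hχ' : χ' (g : ZMod q) = -Complex.I) (u : ℕ) :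
    2 * ((twoPrimeQuaternary p q g h u).val : ℂ) =
      3 * ((1 : MulChar (ZMod p) ℂ) u * (1 : MulChar (ZMod q) ℂ) u) +
      (-1 + Complex.I) * (χ u * χ' u) - (χ ^ 2) u * (χ' ^ 2) u +
      (-1 - Complex.I) * ((χ ^ 3) u * (χ' ^ 3) u) +
      4 * (if (u : ZMod q) = 0 then 1 else 0) := by
  have hp0 := (Fact.out : p.Prime).pos
  have hq0 := (Fact.out : q.Prime).pos
  have hv : ∀ m : ℕ, m < 4 → (m : ZMod 4).val = m := fun m hm => ZMod.val_cast_of_lt hm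
  have hv2 : ((2 : ZMod 4).val : ℂ) = 2 := by exact_mod_cast hv 2 (by norm_num)
  have hv3 : ((3 : ZMod 4).val : ℂ) = 3 := by exact_mod_cast hv 3 (by norm_num)
  have hv1 : ((1 : ZMod 4).val : ℂ) = 1 := by exact_mod_cast hv 1 (by norm_num)
  by_cases hqu : (u : ZMod q) = 0
  · have hd := (ZMod.natCast_eq_zero_iff u q).mp hqu
    rw [twoPrimeQuaternary, if_pos ((natCast_mem_setQ_union_zero_iff hp0 u).mpr hd), hv2, hqu]
    simp only [MulChar.map_zero, if_true]
    norm_num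
  have hqd : ¬ q ∣ u := fun hd => hqu ((ZMod.natCast_eq_zero_iff u q).mpr hd)
  rw [twoPrimeQuaternary, if_neg (mt (natCast_mem_setQ_union_zero_iff hp0 u).mp hqd), if_neg hqu]
  by_cases hpu : (u : ZMod p) = 0
  · have hd := (ZMod.natCast_eq_zero_iff u p).mp hpu
    rw [if_pos ((natCast_mem_setP_iff hq0 hqd).mpr hd), hpu]
    simp [MulChar.map_zero]
  have hpd : ¬ p ∣ u := fun hd => hpu ((ZMod.natCast_eq_zero_iff u p).mpr hd)
  rw [if_neg (mt (natCast_mem_setP_iff hq0 hqd).mp hpd)]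
  have hval : ∀ i, (u : ZMod (p * q)) ∈ cyclotomicClass p q g h i →
      χ u * χ' u = Complex.I ^ i := by
    intro i hi
    obtain ⟨s, h1, h2⟩ := natCast_eq_of_mem_cyclotomicClass hhp hhq hi
    rw [h1, h2, map_pow, map_pow, hχ, hχ', pow_add, mul_right_comm, ← mul_pow, mul_neg,
      Complex.I_mul_I, neg_neg, one_pow, one_mul]
  have hI3 : Complex.I ^ 3 = -Complex.I := by rw [pow_succ, Complex.I_sq]; ring
  have hI1 : Complex.I ≠ 1 := fun e => by simpa using congrArg Complex.im e
  have hIm1 : Complex.I ≠ -1 := fun e => by simpa using congrArg Complex.im e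
  have hInI : Complex.I ≠ -Complex.I := fun e => by
    have := congrArg Complex.im e; norm_num at this
  have h11 : (1 : ℂ) ≠ -1 := by norm_num
  obtain ⟨i, hi4, hi⟩ := exists_mem_cyclotomicClass hpq hgcd hgp hgq hhp hhq hpu hqu
  have hx := hval i hi
  rw [MulChar.one_apply (IsUnit.mk0 _ hpu), MulChar.one_apply (IsUnit.mk0 _ hqu),
    MulChar.pow_apply' _ two_ne_zero, MulChar.pow_apply' _ two_ne_zero,
    MulChar.pow_apply' _ three_ne_zero, MulChar.pow_apply' _ three_ne_zero, ← mul_pow, ← mul_pow,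
    hx]
  have hnot : ∀ j, Complex.I ^ i ≠ Complex.I ^ j →
      (u : ZMod (p * q)) ∉ cyclotomicClass p q g h j := fun j hj hm => hj (hx ▸ hval j hm)
  interval_cases i
  · rw [if_neg (hnot 1 (by simpa using hI1.symm)), if_neg (hnot 2 (by simpa using h11)),
      if_neg (hnot 3 (by rw [hI3, pow_zero]; intro e; simpa using congrArg Complex.im e))]
    simp
    ring
  · rw [if_pos hi, hv1]
    linear_combination (-1 - (-1 - Complex.I) * Complex.I) * Complex.I_sq
  · rw [if_neg (hnot 1 (by simpa using hIm1.symm)), if_pos hi, hv2, Complex.I_sq]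
    ring
  · rw [if_neg (hnot 1 (by simpa [hI3] using hInI.symm)),
      if_neg (hnot 2 (by rw [hI3, Complex.I_sq]; exact fun e => hI1 (neg_injective e))), if_pos hi, hv3, hI3]
    linear_combination (3 + (-1 - Complex.I) * Complex.I) * Complex.I_sq

/-! ### Evaluation of the generating polynomial at roots of unity -/

theorem sum_range_mul_eq_sum_mul_sum [NeZero p] [NeZero q] (hpq : p.Coprime q)
    (F : ZMod p → ℂ) (G : ZMod q → ℂ) :
    ∑ u ∈ Finset.range (p * q), F u * G u = (∑ x, F x) * ∑ y, G y := by
  have : NeZero (p * q) := ⟨mul_ne_zero (NeZero.ne p) (NeZero.ne q)⟩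
  rw [Finset.sum_mul_sum, ← Fintype.sum_prod_type', ← (ZMod.chineseRemainder hpq).toEquiv.sum_comp]
  refine Finset.sum_bij (fun u _ => (u : ZMod (p * q))) (fun _ _ => Finset.mem_univ _) ?_ ?_ ?_
  · intro a ha b hb hab
    rw [ZMod.natCast_eq_natCast_iff] at hab
    exact Nat.ModEq.eq_of_lt_of_lt hab (Finset.mem_range.mp ha) (Finset.mem_range.mp hb)
  · intro x _
    exact ⟨x.val, Finset.mem_range.mpr (ZMod.val_lt x), ZMod.natCast_zmod_val x⟩
  · intro u _
    simp

theorem sum_range_mul_char [NeZero p] [NeZero q] (hpq : p.Coprime q)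
    (χ : MulChar (ZMod p) ℂ) (χ' : MulChar (ZMod q) ℂ) (ψ : AddChar (ZMod p) ℂ)
    (ψ' : AddChar (ZMod q) ℂ) :
    ∑ u ∈ Finset.range (p * q), χ u * χ' u * (ψ 1 * ψ' 1) ^ u =
      gaussSum χ ψ * gaussSum χ' ψ' := by
  rw [gaussSum, gaussSum, ← sum_range_mul_eq_sum_mul_sum hpq]
  refine Finset.sum_congr rfl fun u _ => ?_
  rw [mul_pow, ← AddChar.map_nsmul_eq_pow, ← AddChar.map_nsmul_eq_pow, nsmul_one, nsmul_one]
  ring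

theorem two_mul_sum_twoPrimeQuaternary [Fact p.Prime] [Fact q.Prime] (hpq : p ≠ q)
    (hgcd : Nat.gcd (p - 1) (q - 1) = 4) {g h : ℤ} (hgp : orderOf (g : ZMod p) = p - 1)
    (hgq : orderOf (g : ZMod q) = q - 1) (hhp : h ≡ g [ZMOD (p : ℤ)])
    (hhq : h ≡ 1 [ZMOD (q : ℤ)]) {χ : MulChar (ZMod p) ℂ} {χ' : MulChar (ZMod q) ℂ}
    (hχ : χ (g : ZMod p) = Complex.I) (hχ' : χ' (g : ZMod q) = -Complex.I)
    (ψ : AddChar (ZMod p) ℂ) (ψ' : AddChar (ZMod q) ℂ) :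
    2 * ∑ u ∈ Finset.range (p * q),
        ((twoPrimeQuaternary p q g h u).val : ℂ) * (ψ 1 * ψ' 1) ^ u =
      3 * (gaussSum 1 ψ * gaussSum 1 ψ') +
      (-1 + Complex.I) * (gaussSum χ ψ * gaussSum χ' ψ') -
      gaussSum (χ ^ 2) ψ * gaussSum (χ' ^ 2) ψ' +
      (-1 - Complex.I) * (gaussSum (χ ^ 3) ψ * gaussSum (χ' ^ 3) ψ') + 4 * ∑ x, ψ x := by
  have hcop : p.Coprime q := (Nat.coprime_primes Fact.out Fact.out).mpr hpq
  have hlast : ∑ x, ψ x = ∑ u ∈ Finset.range (p * q),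
      (if (u : ZMod q) = 0 then 1 else 0) * (ψ 1 * ψ' 1) ^ u := by
    have h1 : (1 : ℂ) = ∑ y : ZMod q, (if y = 0 then 1 else 0) * ψ' y := by simp
    rw [← mul_one (∑ x, ψ x)]
    nth_rewrite 1 [h1]
    rw [← sum_range_mul_eq_sum_mul_sum hcop]
    refine Finset.sum_congr rfl fun u _ => ?_
    rw [mul_pow, ← AddChar.map_nsmul_eq_pow, ← AddChar.map_nsmul_eq_pow, nsmul_one, nsmul_one]
    ring
  simp only [← sum_range_mul_char hcop, hlast, Finset.mul_sum]
  rw [← Finset.sum_add_distrib, ← Finset.sum_sub_distrib, ← Finset.sum_add_distrib,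
    ← Finset.sum_add_distrib]
  refine Finset.sum_congr rfl fun u _ => ?_
  rw [← mul_assoc, two_mul_twoPrimeQuaternary_val hpq hgcd hgp hgq hhp hhq hχ hχ']
  ring

end Sequence

/-! ### Congruences for the value of the generating polynomial at `4` -/

section Congruences

variable {p q : ℕ}

theorem isPrimitiveRoot_stdAddChar_one (N : ℕ) [NeZero N] :
    IsPrimitiveRoot (ZMod.stdAddChar (1 : ZMod N)) N := by
  have := ZMod.stdAddChar_coe (N := N) 1
  rw [Int.cast_one, Int.cast_one, mul_one] at this
  rw [this]
  exact Complex.isPrimitiveRoot_exp N (NeZero.ne N)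

theorem stdAddChar_ne_one [Fact p.Prime] : (ZMod.stdAddChar : AddChar (ZMod p) ℂ) ≠ 1 := by
  intro h
  have h1 := isPrimitiveRoot_stdAddChar_one p
  rw [h, AddChar.one_apply] at h1
  exact (Fact.out : p.Prime).one_lt.ne' (h1.eq_orderOf.trans orderOf_one)

/-- The polynomial `∑_{u < pq} e_u X^u` of the two-prime quaternary sequence. -/
noncomputable def twoPrimePolynomial (p q : ℕ) (g h : ℤ) : Polynomial ℤ :=
  ∑ u ∈ Finset.range (p * q),
    Polynomial.C ((twoPrimeQuaternary p q g h u).val : ℤ) * Polynomial.X ^ u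

theorem aeval_twoPrimePolynomial (g h : ℤ) (z : ℂ) :
    Polynomial.aeval z (twoPrimePolynomial p q g h) =
      ∑ u ∈ Finset.range (p * q), ((twoPrimeQuaternary p q g h u).val : ℂ) * z ^ u := by
  simp only [twoPrimePolynomial, map_sum, map_mul, Polynomial.aeval_C, map_pow, Polynomial.aeval_X]
  rfl

theorem eval_twoPrimePolynomial (g h : ℤ) :
    (twoPrimePolynomial p q g h).eval 4 =
      (∑ u ∈ Finset.range (p * q), (twoPrimeQuaternary p q g h u).val * 4 ^ u : ℕ) := by
  rw [twoPrimePolynomial, Polynomial.eval_finsetSum]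
  push_cast
  refine Finset.sum_congr rfl fun u _ => ?_
  rw [Polynomial.eval_mul, Polynomial.eval_C, Polynomial.eval_pow, Polynomial.eval_X]

variable [Fact p.Prime] [Fact q.Prime]

theorem gaussSum_one_one_eq : gaussSum (1 : MulChar (ZMod p) ℂ) 1 = ((p - 1 : ℤ) : ℂ) := by
  rw [gaussSum_one_one, Nat.card_eq_fintype_card, ZMod.card_units,
    Nat.cast_sub (Fact.out : p.Prime).one_le]
  simp

theorem exists_quartic_mulChars (hgcd : Nat.gcd (p - 1) (q - 1) = 4) {g : ℤ}
    (hgp : orderOf (g : ZMod p) = p - 1) (hgq : orderOf (g : ZMod q) = q - 1) :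
    ∃ (χ : MulChar (ZMod p) ℂ) (χ' : MulChar (ZMod q) ℂ),
      χ (g : ZMod p) = Complex.I ∧ χ' (g : ZMod q) = -Complex.I := by
  obtain ⟨a, ha⟩ : 4 ∣ p - 1 := hgcd ▸ Nat.gcd_dvd_left _ _
  obtain ⟨b, hb⟩ : 4 ∣ q - 1 := hgcd ▸ Nat.gcd_dvd_right _ _
  obtain ⟨χ, hχ⟩ := exists_mulChar_apply_eq hgp (μ := Complex.I) (by
    rw [ha, pow_mul, Complex.I_pow_four, one_pow])
  obtain ⟨χ', hχ'⟩ := exists_mulChar_apply_eq hgq (μ := -Complex.I) (by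
    rw [hb, pow_mul, Even.neg_pow (by decide), Complex.I_pow_four, one_pow])
  exact ⟨χ, χ', hχ, hχ'⟩

/-- The four claims come from evaluating at 1, `ζ_p`, `ζ_q` and `ζ_p ζ_q`; the modulus 3 is
`Φ_1(4)`. -/
theorem twoPrimePolynomial_congruences (hpq : p ≠ q) (hgcd : Nat.gcd (p - 1) (q - 1) = 4)
    {g h : ℤ} (hgp : orderOf (g : ZMod p) = p - 1) (hgq : orderOf (g : ZMod q) = q - 1)
    (hhp : h ≡ g [ZMOD (p : ℤ)]) (hhq : h ≡ 1 [ZMOD (q : ℤ)]) {S : ℤ}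
    (hS : S = (twoPrimePolynomial p q g h).eval 4) :
    (3 ∣ 2 * S - (3 * ((p - 1) * (q - 1)) + 4 * p)) ∧
    ((Polynomial.cyclotomic p ℤ).eval 4 ∣ 2 * S + 3 * (q - 1)) ∧
    ((Polynomial.cyclotomic q ℤ).eval 4 ∣ 2 * S - (p + 3)) ∧
    ∃ a b w : ℤ, Even b ∧ a ^ 2 + b ^ 2 = p * q ∧
      (Polynomial.cyclotomic (p * q) ℤ).eval 4 ∣ w ^ 2 - p * q ∧
      (Polynomial.cyclotomic (p * q) ℤ).eval 4 ∣
        (2 * S - 3 + w) ^ 2 - 4 * b * w - 4 * (-1) ^ ((p - 1) / 4 + (q - 1) / 4) * (p * q) := by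
  have hp0 := (Fact.out : p.Prime).pos
  have hq0 := (Fact.out : q.Prime).pos
  have h4p : 4 ∣ p - 1 := hgcd ▸ Nat.gcd_dvd_left _ _
  have h4q : 4 ∣ q - 1 := hgcd ▸ Nat.gcd_dvd_right _ _
  obtain ⟨χ, χ', hχ, hχ'⟩ := exists_quartic_mulChars hgcd hgp hgq
  have hχ2 : χ (g : ZMod p) ^ 2 = -1 := by rw [hχ, Complex.I_sq]
  have hχ2' : χ' (g : ZMod q) ^ 2 = -1 := by rw [hχ', neg_sq, Complex.I_sq]
  have hn2 := quartic_sq_ne_one hχ2 hgp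
  have hn2' := quartic_sq_ne_one hχ2' hgq
  have hn1 : χ ≠ 1 := by rintro rfl; exact hn2 (one_pow 2)
  have hn1' : χ' ≠ 1 := by rintro rfl; exact hn2' (one_pow 2)
  have hn3 : χ ^ 3 ≠ 1 := by rwa [quartic_cube_eq_inv hgp hχ2, inv_ne_one]
  have hn3' : χ' ^ 3 ≠ 1 := by rwa [quartic_cube_eq_inv hgq hχ2', inv_ne_one]
  have hformula := two_mul_sum_twoPrimeQuaternary hpq hgcd hgp hgq hhp hhq hχ hχ'
  simp only [← aeval_twoPrimePolynomial] at hformula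
  set F := twoPrimePolynomial p q g h
  have hcop : p.Coprime q := (Nat.coprime_primes Fact.out Fact.out).mpr hpq
  refine ⟨?_, ?_, ?_, ?_⟩
  · have h1 := hformula 1 1
    rw [gaussSum_one_right hn1, gaussSum_one_right hn2, gaussSum_one_right hn3,
      gaussSum_one_one_eq, gaussSum_one_one_eq] at h1
    rw [AddChar.one_apply, AddChar.one_apply, mul_one] at h1
    have h2 := cyclotomic_eval_dvd_of_aeval_eq_zero one_pos IsPrimitiveRoot.one
      (F := 2 * F - Polynomial.C (3 * ((p - 1) * (q - 1)) + 4 * p : ℤ)) (by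
        rw [map_sub, map_mul, Polynomial.aeval_C, map_ofNat, h1]
        simp) 4
    simpa [hS] using h2
  · have h1 := hformula ZMod.stdAddChar 1
    rw [gaussSum_one_right hn1', gaussSum_one_right hn2', gaussSum_one_right hn3',
      gaussSum_one_one_eq, gaussSum_one_left stdAddChar_ne_one,
      AddChar.sum_eq_zero_of_ne_one stdAddChar_ne_one, AddChar.one_apply, mul_one] at h1
    have h2 := cyclotomic_eval_dvd_of_aeval_eq_zero hp0 (isPrimitiveRoot_stdAddChar_one p)
      (F := 2 * F + Polynomial.C (3 * (q - 1) : ℤ)) (by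
        rw [map_add, map_mul, Polynomial.aeval_C, map_ofNat, h1]
        simp
        ring) 4
    simpa [hS] using h2
  · have h1 := hformula 1 ZMod.stdAddChar
    rw [gaussSum_one_right hn1, gaussSum_one_right hn2, gaussSum_one_right hn3,
      gaussSum_one_one_eq, gaussSum_one_left stdAddChar_ne_one, AddChar.one_apply, one_mul] at h1
    have h2 := cyclotomic_eval_dvd_of_aeval_eq_zero hq0 (isPrimitiveRoot_stdAddChar_one q)
      (F := 2 * F - Polynomial.C (p + 3 : ℤ)) (by
        rw [map_sub, map_mul, Polynomial.aeval_C, map_ofNat, h1]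
        simp
        ring) 4
    simpa [hS] using h2
  · have hζ : IsPrimitiveRoot ((ZMod.stdAddChar (1 : ZMod p) : ℂ) * ZMod.stdAddChar (1 : ZMod q))
        (p * q) := by
      have ho := (isPrimitiveRoot_stdAddChar_one p).eq_orderOf
      have ho' := (isPrimitiveRoot_stdAddChar_one q).eq_orderOf
      have := (Commute.all (ZMod.stdAddChar (1 : ZMod p) : ℂ)
        (ZMod.stdAddChar (1 : ZMod q))).orderOf_mul_eq_mul_orderOf_of_coprime (by rwa [← ho, ← ho'])
      rw [← ho, ← ho'] at this
      rw [← this]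
      exact IsPrimitiveRoot.orderOf _
    have h1 := hformula ZMod.stdAddChar ZMod.stdAddChar
    rw [gaussSum_one_left stdAddChar_ne_one, gaussSum_one_left stdAddChar_ne_one,
      AddChar.sum_eq_zero_of_ne_one stdAddChar_ne_one] at h1
    obtain ⟨hw2, a, b, hb, hab, hX⟩ := two_prime_gaussSum_relations hgp hgq hχ2 hχ2' h4p h4q
      (ZMod.isPrimitive_stdAddChar p) (ZMod.isPrimitive_stdAddChar q)
    -- Quadratic characters take values 0 and ±1, so the product of quadratic Gauss sums is the
    -- value at `ζ_p ζ_q` of an integer polynomial `W`; `w` is `W(4)`.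
    have hc : ∀ u : ℕ, ∃ c : ℤ, (χ ^ 2) (u : ZMod p) * (χ' ^ 2) (u : ZMod q) = c := by
      intro u
      have hint : ∀ z : ℂ, z = 0 ∨ z = 1 ∨ z = -1 → ∃ c : ℤ, z = c := by
        rintro z (rfl | rfl | rfl)
        exacts [⟨0, by simp⟩, ⟨1, by simp⟩, ⟨-1, by simp⟩]
      obtain ⟨c, hc⟩ := hint _ (quartic_sq_isQuadratic hgp hχ2 u)
      obtain ⟨c', hc'⟩ := hint _ (quartic_sq_isQuadratic hgq hχ2' u)
      exact ⟨c * c', by rw [hc, hc']; push_cast; rfl⟩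
    choose c hc using hc
    set W : Polynomial ℤ := ∑ u ∈ Finset.range (p * q), Polynomial.C (c u) * Polynomial.X ^ u
    have hW : Polynomial.aeval ((ZMod.stdAddChar (1 : ZMod p) : ℂ) *
        ZMod.stdAddChar (1 : ZMod q)) W = gaussSum (χ ^ 2) ZMod.stdAddChar *
          gaussSum (χ' ^ 2) ZMod.stdAddChar := by
      rw [← sum_range_mul_char hcop]
      simp only [W, map_sum, map_mul, Polynomial.aeval_C, map_pow, Polynomial.aeval_X, hc]
      rfl
    refine ⟨a, b, W.eval 4, hb, by exact_mod_cast hab, ?_, ?_⟩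
    · have h2 := cyclotomic_eval_dvd_of_aeval_eq_zero (mul_pos hp0 hq0) hζ
        (F := W ^ 2 - Polynomial.C (p * q : ℤ)) (by
          rw [map_sub, map_pow, hW, hw2, Polynomial.aeval_C]
          simp) 4
      simpa using h2
    · have h2 := cyclotomic_eval_dvd_of_aeval_eq_zero (mul_pos hp0 hq0) hζ
        (F := (2 * F - 3 + W) ^ 2 - Polynomial.C (4 * b) * W -
          Polynomial.C (4 * (-1) ^ ((p - 1) / 4 + (q - 1) / 4) * (p * q) : ℤ)) (by
          rw [map_sub, map_sub, map_pow, map_add, map_sub, map_mul, map_mul, map_ofNat, map_ofNat,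
            h1, hW, Polynomial.aeval_C, Polynomial.aeval_C]
          simp only [algebraMap_int_eq, eq_intCast]
          push_cast
          linear_combination hX) 4
      simpa [hS] using h2

end Congruences

/-! ### The greatest common divisor with `4 ^ (p q) - 1` -/

theorem Nat.gcd_mul_of_coprime_gcd {s x y : ℕ} (hs : 0 < s) (h : (Nat.gcd s x).Coprime y) :
    Nat.gcd s (x * y) = Nat.gcd s x * Nat.gcd s y := by
  obtain ⟨g, s', x', hg, hcop, rfl, rfl⟩ := Nat.exists_coprime' (m := s) (n := x)
    (Nat.gcd_pos_of_pos_left _ hs)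
  rw [Nat.gcd_mul_right, hcop.gcd_eq_one, one_mul] at h ⊢
  rw [mul_comm s' g, mul_comm x' g, mul_assoc, Nat.gcd_mul_left, hcop.symm.gcd_mul_left_cancel_right y,
    Nat.Coprime.gcd_mul_left_cancel _ h]

theorem Nat.modEq_one_of_forall_prime_dvd {m : ℕ} (d : ℕ) (hd : d ≠ 0)
    (h : ∀ l : ℕ, l.Prime → l ∣ d → l ≡ 1 [MOD m]) : d ≡ 1 [MOD m] := by
  induction d using Nat.recOnMul with
  | zero => exact absurd rfl hd
  | one => rfl
  | prime l hl => exact h l hl dvd_rfl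
  | mul a b iha ihb =>
    have ha := iha (left_ne_zero_of_mul hd) fun l hl hla => h l hl (hla.mul_right b)
    have hb := ihb (right_ne_zero_of_mul hd) fun l hl hlb => h l hl (hlb.mul_left a)
    simpa using ha.mul hb

theorem two_mul_orderOf_dvd_sub_one {l : ℕ} [Fact l.Prime] (hl2 : l ≠ 2) {x : ZMod l}
    (hx : x ≠ 0) (hodd : Odd (orderOf x)) : 2 * orderOf x ∣ l - 1 := by
  have h1 := ZMod.orderOf_dvd_card_sub_one hx
  have h2 := (Fact.out : l.Prime).eq_two_or_odd
  exact (Nat.coprime_two_left.mpr hodd).mul_dvd_of_dvd_of_dvd (by omega) h1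

theorem natCast_four_pow_eq_one_iff {l n : ℕ} : (4 : ZMod l) ^ n = 1 ↔ l ∣ 4 ^ n - 1 := by
  rw [← ZMod.natCast_eq_zero_iff, Nat.cast_sub (Nat.one_le_pow _ _ (by norm_num)), sub_eq_zero]
  push_cast
  rfl

theorem ne_two_and_four_ne_zero_of_pow_eq_one {l n : ℕ} [Fact l.Prime] (hn : n ≠ 0)
    (h : (4 : ZMod l) ^ n = 1) : l ≠ 2 ∧ (4 : ZMod l) ≠ 0 := by
  have h0 : (4 : ZMod l) ≠ 0 := by
    intro h0
    rw [h0, zero_pow hn] at h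
    exact zero_ne_one h
  refine ⟨?_, h0⟩
  rintro rfl
  exact h0 (by exact_mod_cast (ZMod.natCast_eq_zero_iff 4 2).mpr (by norm_num))

theorem two_mul_dvd_sub_one_of_dvd_four_pow_sub_one {l r : ℕ} (hl : l.Prime) (hl3 : l ≠ 3)
    (hr : r.Prime) (hr2 : Odd r) (h : l ∣ 4 ^ r - 1) : 2 * r ∣ l - 1 := by
  have := Fact.mk hl
  have h1 := natCast_four_pow_eq_one_iff.mpr h
  obtain ⟨hl2, h0⟩ := ne_two_and_four_ne_zero_of_pow_eq_one hr.ne_zero h1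
  rcases (Nat.dvd_prime hr).mp (orderOf_dvd_of_pow_eq_one h1) with ho | ho
  · rw [orderOf_eq_one_iff] at ho
    have : l ∣ 4 ^ 1 - 1 := natCast_four_pow_eq_one_iff.mp (by rw [ho, one_pow])
    exact absurd ((Nat.prime_dvd_prime_iff_eq hl Nat.prime_three).mp this) hl3
  · rw [← ho] at hr2 ⊢
    exact two_mul_orderOf_dvd_sub_one hl2 h0 hr2

theorem dvd_of_dvd_geom_sum {l a n : ℕ} (h : a ≡ 1 [MOD l])
    (hs : l ∣ ∑ i ∈ Finset.range n, a ^ i) : l ∣ n := by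
  rw [← ZMod.natCast_eq_natCast_iff] at h
  rw [← ZMod.natCast_eq_zero_iff] at hs ⊢
  push_cast at hs h
  simpa [h] using hs

section GCD

variable {p q S A B K : ℕ}

/-- Modulo `A` both 2 and 3 are invertible, so `gcd(S, A) = gcd(q - 1, A)`. Replacing `A` by `3A`
adds a factor 3 exactly when `3 ∣ q - 1`, which the definition divides out. -/
theorem rTwo_eq (hA : 3 * A = 4 ^ p - 1) (hA3 : Nat.Coprime 3 A) (hq : 1 ≤ q)
    (hSA : A ∣ 2 * S + 3 * (q - 1)) : rTwo p q = Nat.gcd S A := by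
  have hA2 : Nat.Coprime 2 A := by
    have : Odd (3 * A) := by
      rw [hA]
      rcases Nat.eq_zero_or_pos p with rfl | hp
      · rw [pow_zero, Nat.sub_self, mul_eq_zero] at hA
        rcases hA with h | h
        · omega
        · rw [h] at hA3; norm_num at hA3
      · exact Nat.Even.sub_odd (Nat.one_le_pow _ _ (by norm_num))
          ((show Even 4 by decide).pow_of_ne_zero hp.ne') odd_one
    exact Nat.coprime_two_left.mpr (Nat.odd_mul.mp this).2
  have h1 : Nat.gcd S A = Nat.gcd (q - 1) A := by
    rw [← hA2.gcd_mul_left_cancel S, ← hA3.gcd_mul_left_cancel (q - 1)]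
    apply Nat.dvd_antisymm
    · refine Nat.dvd_gcd ?_ (Nat.gcd_dvd_right _ _)
      exact (Nat.dvd_add_right (Nat.gcd_dvd_left _ _)).mp ((Nat.gcd_dvd_right _ _).trans hSA)
    · refine Nat.dvd_gcd ?_ (Nat.gcd_dvd_right _ _)
      exact (Nat.dvd_add_left (Nat.gcd_dvd_left _ _)).mp ((Nat.gcd_dvd_right _ _).trans hSA)
  rw [h1, rTwo, ← hA]
  split_ifs with h
  · obtain ⟨m, hm⟩ := (Nat.modEq_iff_dvd' hq).mp h.symm
    rw [hm, Nat.gcd_mul_left, Nat.mul_div_cancel_left _ (by norm_num),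
      hA3.gcd_mul_left_cancel]
  · have h3 : Nat.Coprime (q - 1) 3 := by
      rw [Nat.coprime_comm, Nat.Prime.coprime_iff_not_dvd Nat.prime_three]
      exact fun hd => h ((Nat.modEq_iff_dvd' hq).mpr hd).symm
    exact h3.symm.gcd_mul_left_cancel_right A

theorem rOne_eq (hq : q ≠ 0) (hB : 3 * B = 4 ^ q - 1) (hp3 : ¬ 3 ∣ p)
    (hSB : (B : ℤ) ∣ 2 * S - (p + 3)) : rOne p q = Nat.gcd S B := by
  have hB2 : Nat.Coprime 2 B := by
    have : Odd (3 * B) := by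
      rw [hB]
      exact Nat.Even.sub_odd (Nat.one_le_pow _ _ (by norm_num))
          ((show Even 4 by decide).pow_of_ne_zero hq) odd_one
    exact Nat.coprime_two_left.mpr (Nat.odd_mul.mp this).2
  have h3 : Nat.Coprime (p + 3) 3 := by
    rw [Nat.coprime_comm, Nat.Prime.coprime_iff_not_dvd Nat.prime_three]
    omega
  rw [rOne, ← hB, h3.symm.gcd_mul_left_cancel_right B, ← hB2.gcd_mul_left_cancel S]
  have h : 2 * S ≡ p + 3 [MOD B] := by
    refine (Nat.modEq_iff_dvd.mpr ?_).symm
    push_cast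
    exact hSB
  exact h.symm.gcd_eq

theorem gcd_four_pow_sub_one (hp : p.Prime) (hq : q.Prime) (hp_odd : Odd p) (hq_odd : Odd q)
    (hpq : p ≠ q) (hp3 : p ≠ 3) (hq3 : q ≠ 3) (hA : 3 * A = 4 ^ p - 1) (hB : 3 * B = 4 ^ q - 1)
    (hA3 : Nat.Coprime 3 A) (hKB : K * B = ∑ i ∈ Finset.range q, (4 ^ p) ^ i)
    (hKA : K * A = ∑ i ∈ Finset.range p, (4 ^ q) ^ i) (hSA : A ∣ 2 * S + 3 * (q - 1))
    (hSB : (B : ℤ) ∣ 2 * S - (p + 3)) (hS : ¬ 3 ∣ S) (hS0 : 0 < S) :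
    Nat.gcd S (4 ^ (p * q) - 1) = max (rOne p q) (rTwo p q) * Nat.gcd S K ∧
      ∀ l : ℕ, l.Prime → l ∣ Nat.gcd S K → orderOf (4 : ZMod l) = p * q ∧ 2 * (p * q) ∣ l - 1 := by
  have hr1 := rOne_eq hq.ne_zero hB
    (fun h => hp3 ((Nat.prime_dvd_prime_iff_eq Nat.prime_three hp).mp h).symm) hSB
  have hr2 := rTwo_eq hA hA3 hq.one_le hSA
  have hprod : 4 ^ (p * q) - 1 = 3 * (A * (B * K)) := by
    have h1 := Nat.geomSum_eq (m := 4 ^ p) (Nat.one_lt_pow hp.ne_zero (by norm_num) |>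
      fun h => (h : 2 ≤ 4 ^ p)) q
    have h2 : 4 ^ p - 1 ∣ (4 ^ p) ^ q - 1 := by simpa using Nat.sub_dvd_pow_sub_pow (4 ^ p) 1 q
    rw [← hKB] at h1
    rw [pow_mul, ← Nat.mul_div_cancel' h2, ← h1, ← hA]
    ring
  have hl3 : ∀ {l : ℕ}, l ∣ S → l ≠ 3 := by
    rintro l hl rfl
    exact hS hl
  have four_pow_modEq : ∀ {l r C : ℕ}, 3 * C = 4 ^ r - 1 → l ∣ C → 4 ^ r ≡ 1 [MOD l] := by
    intro l r C hC hl
    exact ((Nat.modEq_iff_dvd' (Nat.one_le_pow _ _ (by norm_num))).mpr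
      (hC ▸ hl.mul_left 3)).symm
  have hAB : ∀ {l : ℕ}, l.Prime → l ∣ S → 4 ^ p ≡ 1 [MOD l] → 4 ^ q ≡ 1 [MOD l] → False := by
    intro l hl hlS h1 h2
    have := Fact.mk hl
    rw [← ZMod.natCast_eq_natCast_iff] at h1 h2
    push_cast at h1 h2
    have h := Nat.dvd_gcd (orderOf_dvd_of_pow_eq_one h1) (orderOf_dvd_of_pow_eq_one h2)
    rw [((Nat.coprime_primes hp hq).mpr hpq).gcd_eq_one, Nat.dvd_one, orderOf_eq_one_iff] at h
    have h3 : l ∣ 4 ^ 1 - 1 := natCast_four_pow_eq_one_iff.mp (by rw [h, one_pow])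
    exact hl3 hlS ((Nat.prime_dvd_prime_iff_eq hl Nat.prime_three).mp h3)
  have not_dvd_A : ∀ {l : ℕ}, l.Prime → l ∣ S → l ∣ K → ¬ 4 ^ p ≡ 1 [MOD l] := by
    intro l hl hlS hlK h
    -- Modulo `l` the geometric sum `K * B` is `q`, so `l = q`; then `q ∣ A` would give `q ∣ 3(q -
    -- 1)`.
    have hlq := (Nat.prime_dvd_prime_iff_eq hl hq).mp
      (dvd_of_dvd_geom_sum h (hKB ▸ hlK.mul_right B))
    subst hlq
    have hlA : l ∣ A := by
      have : l ∣ 3 * A := hA ▸ (Nat.modEq_iff_dvd' (Nat.one_le_pow _ _ (by norm_num))).mp h.symm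
      exact (hl.dvd_mul.mp this).resolve_left fun h3 =>
        hq3 ((Nat.prime_dvd_prime_iff_eq hl Nat.prime_three).mp h3)
    have h1 := (Nat.dvd_add_right (hlS.mul_left 2)).mp (hlA.trans hSA)
    rcases hl.dvd_mul.mp h1 with h3 | h3
    · exact hq3 ((Nat.prime_dvd_prime_iff_eq hl Nat.prime_three).mp h3)
    · have := Nat.le_of_dvd (Nat.sub_pos_of_lt hl.one_lt) h3
      have := hl.one_lt
      omega
  have not_dvd_B : ∀ {l : ℕ}, l.Prime → l ∣ S → l ∣ K → ¬ 4 ^ q ≡ 1 [MOD l] := by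
    intro l hl hlS hlK h
    -- Symmetrically `l = p`, and `p ∣ 2S - (p + 3)` would give `p ∣ 3`.
    have hlp := (Nat.prime_dvd_prime_iff_eq hl hp).mp
      (dvd_of_dvd_geom_sum h (hKA ▸ hlK.mul_right A))
    subst hlp
    have hlB : l ∣ B := by
      have : l ∣ 3 * B := hB ▸ (Nat.modEq_iff_dvd' (Nat.one_le_pow _ _ (by norm_num))).mp h.symm
      exact (hl.dvd_mul.mp this).resolve_left fun h3 =>
        hp3 ((Nat.prime_dvd_prime_iff_eq hl Nat.prime_three).mp h3)
    have h1 : (l : ℤ) ∣ 2 * S - (l + 3) := (Int.natCast_dvd_natCast.mpr hlB).trans hSB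
    have h2 : (l : ℤ) ∣ 3 := by
      have h4 : (l : ℤ) ∣ 2 * S := (Int.natCast_dvd_natCast.mpr hlS).mul_left 2
      have h5 := dvd_sub (dvd_sub h4 h1) (dvd_refl (l : ℤ))
      rwa [show (2 * S - (2 * S - (l + 3)) - l : ℤ) = 3 by ring] at h5
    exact hp3 ((Nat.prime_dvd_prime_iff_eq hl Nat.prime_three).mp (by exact_mod_cast h2))
  refine ⟨?_, ?_⟩
  · have e1 : (Nat.gcd S A).Coprime (B * K) := by
      refine Nat.Coprime.mul_right ?_ ?_ <;>
        refine Nat.coprime_of_dvd fun l hl h1 h2 => ?_ <;>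
        have hlS := h1.trans (Nat.gcd_dvd_left _ _) <;>
        have hlA := four_pow_modEq hA (h1.trans (Nat.gcd_dvd_right _ _))
      · exact hAB hl hlS hlA (four_pow_modEq hB h2)
      · exact not_dvd_A hl hlS h2 hlA
    have e2 : (Nat.gcd S B).Coprime K := Nat.coprime_of_dvd fun l hl h1 h2 =>
      not_dvd_B hl (h1.trans (Nat.gcd_dvd_left _ _)) h2
        (four_pow_modEq hB (h1.trans (Nat.gcd_dvd_right _ _)))
    have e3 : Nat.Coprime S 3 := by
      rwa [Nat.coprime_comm, Nat.Prime.coprime_iff_not_dvd Nat.prime_three]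
    rw [hprod, e3.symm.gcd_mul_left_cancel_right, Nat.gcd_mul_of_coprime_gcd hS0 e1,
      Nat.gcd_mul_of_coprime_gcd hS0 e2, ← mul_assoc]
    congr 1
    -- Otherwise primes `l ≥ 2p + 1` dividing `q - 1` and `t ≥ 2q + 1` dividing `p + 3` would exist,
    -- which is impossible by size.
    have hone : Nat.gcd S A = 1 ∨ Nat.gcd S B = 1 := by
      by_contra! hne
      obtain ⟨l, hl, hl'⟩ := Nat.exists_prime_and_dvd hne.1
      obtain ⟨t, ht, ht'⟩ := Nat.exists_prime_and_dvd hne.2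
      have h1 := two_mul_dvd_sub_one_of_dvd_four_pow_sub_one hl
        (hl3 (hl'.trans (Nat.gcd_dvd_left _ _))) hp hp_odd
        (hA ▸ (hl'.trans (Nat.gcd_dvd_right _ _)).mul_left 3)
      have h2 := two_mul_dvd_sub_one_of_dvd_four_pow_sub_one ht
        (hl3 (ht'.trans (Nat.gcd_dvd_left _ _))) hq hq_odd
        (hB ▸ (ht'.trans (Nat.gcd_dvd_right _ _)).mul_left 3)
      have h3 : l ∣ q - 1 := by
        have h := (Nat.dvd_add_right ((hl'.trans (Nat.gcd_dvd_left _ _)).mul_left 2)).mp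
          ((hl'.trans (Nat.gcd_dvd_right _ _)).trans hSA)
        exact (hl.dvd_mul.mp h).resolve_left fun h' => hl3 (hl'.trans (Nat.gcd_dvd_left _ _))
          ((Nat.prime_dvd_prime_iff_eq hl Nat.prime_three).mp h')
      have h4 : t ∣ p + 3 := by
        rw [← hr1] at ht'
        exact ht'.trans (Nat.gcd_dvd_left _ _)
      have := hl.one_lt
      have := ht.one_lt
      have := hp.two_le
      have := hq.two_le
      have := Nat.le_of_dvd (by omega) h1
      have := Nat.le_of_dvd (by omega) h2
      have := Nat.le_of_dvd (by omega) h3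
      have := Nat.le_of_dvd (by omega) h4
      omega
    have hposA : 0 < Nat.gcd S A := Nat.gcd_pos_of_pos_left _ hS0
    have hposB : 0 < Nat.gcd S B := Nat.gcd_pos_of_pos_left _ hS0
    rw [hr1, hr2]
    rcases hone with h | h <;> rw [h]
    · rw [one_mul, max_eq_left hposB]
    · rw [mul_one, max_eq_right hposA]
  · intro l hl hld
    have hlS := hld.trans (Nat.gcd_dvd_left _ _)
    have hlK := hld.trans (Nat.gcd_dvd_right _ _)
    have := Fact.mk hl
    have hA' := not_dvd_A hl hlS hlK
    have hB' := not_dvd_B hl hlS hlK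
    rw [← ZMod.natCast_eq_natCast_iff] at hA' hB'
    push_cast at hA' hB'
    have h1 : (4 : ZMod l) ^ (p * q) = 1 := natCast_four_pow_eq_one_iff.mpr
      (hprod ▸ ((hlK.mul_left B).mul_left A).mul_left 3)
    have ho : orderOf (4 : ZMod l) = p * q := by
      obtain ⟨x, y, hx, hy, hxy⟩ := Nat.dvd_mul.mp (orderOf_dvd_of_pow_eq_one h1)
      rcases (Nat.dvd_prime hp).mp hx with rfl | rfl
      · exact absurd (orderOf_dvd_iff_pow_eq_one.mp (by rwa [← hxy, one_mul])) hB'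
      rcases (Nat.dvd_prime hq).mp hy with rfl | rfl
      · exact absurd (orderOf_dvd_iff_pow_eq_one.mp (by rw [← hxy, mul_one])) hA'
      exact hxy.symm
    obtain ⟨hl2, h0⟩ := ne_two_and_four_ne_zero_of_pow_eq_one
      (mul_ne_zero hp.ne_zero hq.ne_zero) h1
    refine ⟨ho, ?_⟩
    rw [← ho]
    exact two_mul_orderOf_dvd_sub_one hl2 h0 (ho ▸ hp_odd.mul hq_odd)

end GCD

/-! ### Residues of divisors whose primes give 4 the order `n` -/

theorem Nat.Prime.mod_eight_ne_five_of_four_pow_odd {d n : ℕ} (hd : d.Prime) (hn : Odd n)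
    (h : (4 : ZMod d) ^ n = 1) : d % 8 ≠ 5 := by
  have := Fact.mk hd
  have hd2 := (ne_two_and_four_ne_zero_of_pow_eq_one hn.pos.ne' h).1
  obtain ⟨m, rfl⟩ := hn
  have h2 : (2 : ZMod d) ^ (2 * m + 1) * 2 ^ (2 * m + 1) = 1 := by
    rw [← mul_pow, ← h]; norm_num
  -- With odd exponent `2m + 1`, the square of `2^(m+1)` is 2 or -2, so one of these is a quadratic
  -- residue modulo `d`.
  rcases mul_self_eq_one_iff.mp h2 with h3 | h3
  · have : IsSquare (2 : ZMod d) := ⟨2 ^ (m + 1), by linear_combination (-2) * h3⟩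
    rw [ZMod.exists_sq_eq_two_iff hd2] at this
    omega
  · have : IsSquare (-2 : ZMod d) := ⟨2 ^ (m + 1), by linear_combination (-2) * h3⟩
    rw [ZMod.exists_sq_eq_neg_two_iff hd2] at this
    omega

theorem not_dvd_of_two_mul_dvd_sub_one {d n l : ℕ} (hn : l ≤ n)
    (h : ∀ l : ℕ, l.Prime → l ∣ d → orderOf (4 : ZMod l) = n ∧ 2 * n ∣ l - 1) (hl : l.Prime) :
    ¬ l ∣ d := by
  intro hld
  have h1 := Nat.le_of_dvd (Nat.sub_pos_of_lt hl.one_lt) (h l hl hld).2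
  have := hl.one_lt
  omega

theorem prime_dvd_modEq_one {d n l : ℕ}
    (h : ∀ l : ℕ, l.Prime → l ∣ d → orderOf (4 : ZMod l) = n ∧ 2 * n ∣ l - 1) (hl : l.Prime)
    (hld : l ∣ d) : l ≡ 1 [MOD 2 * n] :=
  ((Nat.modEq_iff_dvd' hl.one_le).mpr (h l hl hld).2).symm

/-- The bound on `k` makes `d` prime: a factorization `(2nx + 1)(2ny + 1)` with `x, y ≥ 1` gives `k
= 2nxy + x + y > 2n`. -/
theorem mod_eight_ne_five_of_orderOf_prime_factors {d n k : ℕ} (hn : Odd n) (hk : 1 ≤ k)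
    (hkn : k ≤ 2 * n) (hd : d = 1 + 2 * k * n)
    (h : ∀ l : ℕ, l.Prime → l ∣ d → orderOf (4 : ZMod l) = n ∧ 2 * n ∣ l - 1) : d % 8 ≠ 5 := by
  have hn0 := hn.pos
  have hd1 : d ≠ 1 := by
    have : 0 < 2 * k * n := by positivity
    omega
  obtain ⟨l, hl, m, rfl⟩ := Nat.exists_prime_and_dvd hd1
  have hm0 : m ≠ 0 := by
    rintro rfl
    omega
  have hm : m ≡ 1 [MOD 2 * n] := Nat.modEq_one_of_forall_prime_dvd m hm0 fun t ht htm =>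
    prime_dvd_modEq_one h ht (htm.mul_left l)
  obtain ⟨x, hx⟩ := (h l hl (dvd_mul_right l m)).2
  obtain ⟨y, hy⟩ := (Nat.modEq_iff_dvd' (Nat.one_le_iff_ne_zero.mpr hm0)).mp hm.symm
  have hx' : l = 2 * n * x + 1 := by have := hl.one_lt; omega
  have hy' : m = 2 * n * y + 1 := by omega
  have hx0 : 1 ≤ x := by
    rcases Nat.eq_zero_or_pos x with rfl | hx0
    · rw [mul_zero, zero_add] at hx'
      exact absurd hx' hl.ne_one
    · exact hx0
  have hm1 : m = 1 := by
    rcases Nat.eq_zero_or_pos y with rfl | hy0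
    · simpa using hy'
    · exfalso
      have e : 2 * n * k = 2 * n * (2 * n * x * y + x + y) := by
        rw [hx', hy'] at hd
        linarith [hd]
      have e2 := Nat.eq_of_mul_eq_mul_left (by positivity) e
      have : 2 * n * 1 ≤ 2 * n * (x * y) := Nat.mul_le_mul_left _ (Nat.mul_pos hx0 hy0)
      linarith [mul_assoc (2 * n) x y]
  subst hm1
  rw [mul_one] at h ⊢
  exact hl.mod_eight_ne_five_of_four_pow_odd hn
    (by rw [← (h l hl dvd_rfl).1]; exact pow_orderOf_eq_one _)

theorem sixty_five_le_mul {p q : ℕ} (hp : p.Prime) (hq : q.Prime) (hpq : p ≠ q)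
    (hp4 : 4 ∣ p - 1) (hq4 : 4 ∣ q - 1) : 65 ≤ p * q := by
  have key : ∀ {r : ℕ}, r.Prime → 4 ∣ r - 1 → r = 5 ∨ 13 ≤ r := by
    intro r hr hr4
    have := hr.two_le
    have : r ≠ 9 := by rintro rfl; norm_num at hr
    omega
  rcases key hp hp4 with rfl | h1 <;> rcases key hq hq4 with rfl | h2
  · exact absurd rfl hpq
  · linarith
  · linarith
  · nlinarith

/-! ### The full gcd and the complexity -/

theorem exists_gcd_twoPrimeQuaternary {p q : ℕ} (hp : p.Prime) (hq : q.Prime) (hp_odd : Odd p)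
    (hq_odd : Odd q) (hpq : p ≠ q) (hgcd : Nat.gcd (p - 1) (q - 1) = 4) {g h : ℤ}
    (hgp : orderOf (g : ZMod p) = p - 1) (hgq : orderOf (g : ZMod q) = q - 1)
    (hhp : h ≡ g [ZMOD (p : ℤ)]) (hhq : h ≡ 1 [ZMOD (q : ℤ)]) :
    ∃ (d : ℕ) (a b : ℤ), Nat.gcd (∑ u ∈ Finset.range (p * q),
        (twoPrimeQuaternary p q g h u).val * 4 ^ u) (4 ^ (p * q) - 1) =
          max (rOne p q) (rTwo p q) * d ∧ d ≠ 0 ∧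
      (∀ l : ℕ, l.Prime → l ∣ d → orderOf (4 : ZMod l) = p * q ∧ 2 * (p * q) ∣ l - 1) ∧
      Even b ∧ a ^ 2 + b ^ 2 = p * q ∧
      (d : ℤ) ∣ (9 + (1 - 4 * (-1) ^ ((p - 1) / 4 + (q - 1) / 4)) * (p * q)) ^ 2 -
        (6 + 4 * b) ^ 2 * (p * q) := by
  have := Fact.mk hp
  have := Fact.mk hq
  have h4p : 4 ∣ p - 1 := hgcd ▸ Nat.gcd_dvd_left _ _
  have h4q : 4 ∣ q - 1 := hgcd ▸ Nat.gcd_dvd_right _ _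
  have hp3 : p ≠ 3 := by rintro rfl; norm_num at h4p
  have hq3 : q ≠ 3 := by rintro rfl; norm_num at h4q
  obtain ⟨S, hS⟩ : ∃ S, S = ∑ u ∈ Finset.range (p * q),
    (twoPrimeQuaternary p q g h u).val * 4 ^ u := ⟨_, rfl⟩
  have hSeval : (S : ℤ) = (twoPrimePolynomial p q g h).eval 4 := by
    rw [eval_twoPrimePolynomial, hS]
  obtain ⟨c3, cA, cB, a, b, w, hb, hab, hw, hX⟩ :=
    twoPrimePolynomial_congruences hpq hgcd hgp hgq hhp hhq hSeval
  have hcyc : ∀ (r : ℕ) [Fact r.Prime] (x : ℕ), (Polynomial.cyclotomic r ℤ).eval (x : ℤ) =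
      (∑ i ∈ Finset.range r, x ^ i : ℕ) := by
    intro r _ x
    rw [Polynomial.cyclotomic_prime, Polynomial.eval_finsetSum]
    simp
  have hgeom : ∀ r : ℕ, 3 * (∑ i ∈ Finset.range r, 4 ^ i) = 4 ^ r - 1 := by
    intro r
    have h1 := geom_sum_mul_add 3 r
    norm_num at h1
    omega
  have hK0 := Polynomial.cyclotomic_pos (n := p * q) (by
    linarith [sixty_five_le_mul hp hq hpq h4p h4q]) (4 : ℤ)
  obtain ⟨K, hK⟩ := Int.eq_ofNat_of_zero_le hK0.le
  have hKmul : ∀ (r t : ℕ) [Fact r.Prime] [Fact t.Prime], r ≠ t → r * t = p * q →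
      K * ∑ i ∈ Finset.range t, 4 ^ i = ∑ i ∈ Finset.range t, (4 ^ r) ^ i := by
    intro r t hr ht hrt hmul
    have h1 := congrArg (Polynomial.eval (4 : ℤ)) (Polynomial.cyclotomic_expand_eq_cyclotomic_mul
      hr.out (fun hd => hrt ((Nat.prime_dvd_prime_iff_eq hr.out ht.out).mp hd)) ℤ)
    have h2 := hcyc t 4
    have h3 := hcyc t (4 ^ r)
    rw [Polynomial.expand_eval, Polynomial.eval_mul, mul_comm t r, hmul, hK] at h1
    push_cast at h2 h3
    rw [h2, h3] at h1
    exact_mod_cast h1.symm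
  have hA3 : Nat.Coprime 3 (∑ i ∈ Finset.range p, 4 ^ i) := by
    rw [Nat.Prime.coprime_iff_not_dvd Nat.prime_three]
    intro hd
    exact hp3 ((Nat.prime_dvd_prime_iff_eq Nat.prime_three hp).mp
      (dvd_of_dvd_geom_sum (by decide) hd)).symm
  have hS3 : ¬ 3 ∣ S := by
    intro hd
    -- The congruence `c3` reduces to `2S ≡ 4p` modulo 3.
    have h1 : (3 : ℤ) ∣ p := by
      have : (3 : ℤ) ∣ S := by exact_mod_cast hd
      obtain ⟨x, hx⟩ := this
      obtain ⟨y, hy⟩ := c3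
      generalize ((p : ℤ) - 1) * (q - 1) = z at hy
      omega
    exact hp3 ((Nat.prime_dvd_prime_iff_eq Nat.prime_three hp).mp (by exact_mod_cast h1)).symm
  have hS0 : 0 < S := Nat.pos_of_ne_zero fun h0 => hS3 (by rw [h0]; exact dvd_zero 3)
  have hcA := hcyc p 4
  have hcB := hcyc q 4
  rw [Nat.cast_ofNat] at hcA hcB
  rw [hcA] at cA
  rw [hcB] at cB
  rw [hK] at hw hX
  obtain ⟨hgcdS, hprimes⟩ := gcd_four_pow_sub_one (S := S) hp hq hp_odd hq_odd hpq hp3 hq3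
    (hgeom p) (hgeom q) hA3 (hKmul p q hpq rfl) (hKmul q p hpq.symm (mul_comm q p))
    (by
      rw [← Int.natCast_dvd_natCast, Nat.cast_add, Nat.cast_mul, Nat.cast_mul,
        Nat.cast_sub hq.one_le]
      exact_mod_cast cA) cB hS3 hS0
  refine ⟨Nat.gcd S K, a, b, hS ▸ hgcdS, ?_, hprimes, hb, hab, ?_⟩
  · exact (Nat.gcd_pos_of_pos_left _ hS0).ne'
  · have hdS : ((Nat.gcd S K : ℕ) : ℤ) ∣ S := Int.natCast_dvd_natCast.mpr (Nat.gcd_dvd_left _ _)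
    have hdK : ((Nat.gcd S K : ℕ) : ℤ) ∣ K := Int.natCast_dvd_natCast.mpr (Nat.gcd_dvd_right _ _)
    obtain ⟨x, hx⟩ := hdS
    obtain ⟨y, hy⟩ := hdK.trans hw
    obtain ⟨z, hz⟩ := hdK.trans hX
    obtain ⟨E, hE⟩ : ∃ E : ℤ, E = (-1) ^ ((p - 1) / 4 + (q - 1) / 4) := ⟨_, rfl⟩
    rw [← hE] at hz ⊢
    -- Since `S ≡ 0` and `w² ≡ pq` modulo the gcd, the quadratic relation becomes linear in `w`;
    -- multiplying by the conjugate expression then eliminates `w`.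
    have h1 : ((Nat.gcd S K : ℕ) : ℤ) ∣
        9 + (1 - 4 * E) * (p * q) - (6 + 4 * b) * w := by
      refine ⟨z - y - 4 * x * (S - 3 + w), ?_⟩
      linear_combination hz - hy - 4 * (S - 3 + w) * hx
    obtain ⟨v, hv⟩ := h1
    refine ⟨v * (9 + (1 - 4 * E) * (p * q) + (6 + 4 * b) * w) + (6 + 4 * b) ^ 2 * y, ?_⟩
    linear_combination (9 + (1 - 4 * E) * (p * q) + (6 + 4 * b) * w) * hv + (6 + 4 * b) ^ 2 * hy

theorem theorem1 (p q : ℕ) (hp : p.Prime) (hq : q.Prime) (hp_odd : Odd p) (hq_odd : Odd q)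
    (hpq : p ≠ q) (hgcd : Nat.gcd (p - 1) (q - 1) = 4)
    (g h : ℤ)
    (hgp : orderOf ((g : ℤ) : ZMod p) = p - 1) (hgq : orderOf ((g : ℤ) : ZMod q) = q - 1)
    (hhp : h ≡ g [ZMOD (p : ℤ)]) (hhq : h ≡ 1 [ZMOD (q : ℤ)]) :
    (p ≡ q + 4 [MOD 8] →
      mAdicComplexity 4 (twoPrimeQuaternary p q g h) =
          ⌈Real.logb 4 (((4 : ℝ) ^ (p * q) - 1) / (max (rOne p q) (rTwo p q) : ℕ))⌉ ∨
      mAdicComplexity 4 (twoPrimeQuaternary p q g h) =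
          ⌈Real.logb 4 (((4 : ℝ) ^ (p * q) - 1) /
            ((2 * (p : ℝ) * (q : ℝ) + 1) * (max (rOne p q) (rTwo p q) : ℕ)))⌉) ∧
    (p ≡ 5 [MOD 8] ∧ q ≡ 5 [MOD 8] →
      mAdicComplexity 4 (twoPrimeQuaternary p q g h) =
          ⌈Real.logb 4 (((4 : ℝ) ^ (p * q) - 1) / (max (rOne p q) (rTwo p q) : ℕ))⌉ ∨
      mAdicComplexity 4 (twoPrimeQuaternary p q g h) =
          ⌈Real.logb 4 (((4 : ℝ) ^ (p * q) - 1) /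
            ((6 * (p : ℝ) * (q : ℝ) + 1) * (max (rOne p q) (rTwo p q) : ℕ)))⌉) := by
  have h4p : 4 ∣ p - 1 := hgcd ▸ Nat.gcd_dvd_left _ _
  have h4q : 4 ∣ q - 1 := hgcd ▸ Nat.gcd_dvd_right _ _
  have hp1 := hp.one_lt
  have hq1 := hq.one_lt
  have hn65 := sixty_five_le_mul hp hq hpq h4p h4q
  obtain ⟨d, a, b, hG, hd0, hprimes, hb, hab, hdvd⟩ :=
    exists_gcd_twoPrimeQuaternary hp hq hp_odd hq_odd hpq hgcd hgp hgq hhp hhq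
  have hcomp := mAdicComplexity_of_periodic 4 (by norm_num) (twoPrimeQuaternary p q g h) (p * q)
    (by omega) (twoPrimeQuaternary_periodic g h)
  rw [hG, Nat.cast_mul, mul_comm (_ : ℝ) (d : ℝ)] at hcomp
  have hdmod := Nat.modEq_one_of_forall_prime_dvd d hd0 fun l hl hld =>
    prime_dvd_modEq_one hprimes hl hld
  obtain ⟨k, hk⟩ := (Nat.modEq_iff_dvd' (Nat.one_le_iff_ne_zero.mpr hd0)).mp hdmod.symm
  have hdk : d = 1 + 2 * k * (p * q) := by
    have : 2 * k * (p * q) = 2 * (p * q) * k := by ring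
    omega
  rcases Nat.eq_zero_or_pos k with rfl | hk0
  · have hd1 : d = 1 := by simpa using hdk
    rw [hd1, Nat.cast_one, one_mul] at hcomp
    exact ⟨fun _ => Or.inl hcomp, fun _ => Or.inl hcomp⟩
  have hd8 : (k : ℤ) ≤ 2 * (p * q) → (d : ℤ) % 8 ≠ 5 := by
    intro hle
    have := mod_eight_ne_five_of_orderOf_prime_factors (hp_odd.mul hq_odd) hk0
      (by exact_mod_cast hle) hdk hprimes
    omega
  have hdk' : (d : ℤ) = 1 + 2 * k * (p * q) := by exact_mod_cast hdk
  have hn65' : (65 : ℤ) ≤ p * q := by exact_mod_cast hn65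
  constructor
  · intro h8
    right
    have hp8 : p % 8 = (q + 4) % 8 := h8
    have hn8 : ((p : ℤ) * q) % 8 = 5 := by
      have : (p * q) % 8 = 5 := by
        rw [Nat.mul_mod]
        have : q % 8 = 1 ∨ q % 8 = 5 := by omega
        rcases this with h | h <;> rw [show p % 8 = (q % 8 + 4) % 8 by omega, h]
      exact_mod_cast congrArg (Nat.cast : ℕ → ℤ) this
    -- Exactly one of the two quotients is odd, so the sign is -1 and the coefficient `1 - 4ε` is 5.
    have hodd : Odd ((p - 1) / 4 + (q - 1) / 4) := by
      rw [Nat.odd_iff]; omega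
    rw [hodd.neg_one_pow] at hdvd
    have hk1 := eq_one_of_dvd_norm_of_mod_eight_eq_five hab.symm hn8 hb hn65'
      (by exact_mod_cast hk0) hdk' (by convert hdvd using 3; ring)
      (by exact_mod_cast not_dvd_of_two_mul_dvd_sub_one (by omega) hprimes (by norm_num)) hd8
    have hd1 : (d : ℝ) = 2 * (p : ℝ) * (q : ℝ) + 1 := by
      have : k = 1 := by exact_mod_cast hk1
      rw [hdk, this]; push_cast; ring
    rw [← hd1]
    exact hcomp
  · rintro ⟨h5, h5'⟩
    right
    have hp8 : p % 8 = 5 := h5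
    have hq8 : q % 8 = 5 := h5'
    have hn8 : ((p : ℤ) * q) % 8 = 1 := by
      have : (p * q) % 8 = 1 := by rw [Nat.mul_mod, hp8, hq8]
      exact_mod_cast congrArg (Nat.cast : ℕ → ℤ) this
    -- Both quotients are odd, so the sign is +1 and the coefficient is -3.
    have heven : Even ((p - 1) / 4 + (q - 1) / 4) := by
      rw [Nat.even_iff]; omega
    rw [heven.neg_one_pow] at hdvd
    have hn3 : ¬ 3 ∣ p * q := by
      rw [Nat.prime_three.dvd_mul, Nat.prime_dvd_prime_iff_eq Nat.prime_three hp,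
        Nat.prime_dvd_prime_iff_eq Nat.prime_three hq]
      omega
    have hk3 := eq_three_of_dvd_norm_of_mod_eight_eq_one hab.symm hn8 hb hn65'
      (by exact_mod_cast hk0) hdk' (by convert hdvd using 3; ring) (by exact_mod_cast hn3)
      (by exact_mod_cast not_dvd_of_two_mul_dvd_sub_one (by omega) hprimes Nat.prime_three) hd8
    have hd1 : (d : ℝ) = 6 * (p : ℝ) * (q : ℝ) + 1 := by
      have : k = 3 := by exact_mod_cast hk3
      rw [hdk, this]; push_cast; ring
    rw [← hd1]
    exact hcomp
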